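/- Let $\mathbb{R}_{\max}=\mathbb{R}\cup\{-\infty\}$ with $a\oplus b=\max(a,b)$ and $a\otimes b=a+b$; its zero is $-\infty$ and its one is $0$. Matrix products and powers are max-plus, $A^0$ is the max-plus identity matrix, and $\lambda^{\otimes t}=t\lambda$. For $A\in\mathbb{R}_{\max}^{n\times n}$ let $\mathcal{D}(A)$ be the digraph on $\{1,\dots,n\}$ whose edges are the pairs $(i,j)$ with $a_{ij}\neq-\infty$, weighted by $a_{ij}$. Let $\mathrm{cr}(\mathcal{D}(A))$ be the greatest length of a cycle of $\mathcal{D}(A)$ ($0$ if there is none). If $\mathcal{D}(A)$ has a nonempty cycle, let $\lambda(A)\in\mathbb{R}$ be the maximal mean weight of its nonempty cycles, and let the critical graph $\mathcal{G}^c(A)$ consist of the nodes and edges of the nonempty closed walks of mean weight $\lambda(A)$. The cyclicity $\gamma(\mathcal{G})$ of a digraph $\mathcal{G}$ is the least common multiple, over its strongly connected components, of the greatest common divisor of the lengths of the closed walks of the component. A *representing subgraph* of $\mathcal{G}^c(A)$ is a subgraph $\mathcal{G}$, each of whose nodes is an endpoint of an edge of $\mathcal{G}$, with no edges between distinct strongly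 connected components of $\mathcal{G}$, and such that every strongly connected component of $\mathcal{G}^c(A)$ contains exactly one of $\mathcal{G}$ (for example $\mathcal{G}=\mathcal{G}^c(A)$). The *CSR terms* $C,S,R$ of $A$ with respect to $\mathcal{G}$ are the following $n\times n$ matrices. Let $\tilde A$ be the matrix with entries $a_{ij}-\lambda(A)$ and let $M=\bigoplus_{s\ge 0}\tilde A^{\,s\gamma(\mathcal{G})}$. Then $c_{ij}=m_{ij}$ if $j$ is a node of $\mathcal{G}$, $r_{ij}=m_{ij}$ if $i$ is a node of $\mathcal{G}$, $s_{ij}=\tilde a_{ij}$ if $(i,j)$ is an edge of $\mathcal{G}$, and all other entries of $C,S,R$ are $-\infty$. A matrix is *Boolean* if its entries are $-\infty$ or $0$, and $S$ is *diagonally similar* to $P$ if there are $d_1,\dots,d_n\in\mathbb{R}$ with $p_{ij}=-d_i+s_{ij}+d_j$ for all $i,j$. Put $\mathrm{Wi}(1)=0$ and $\mathrm{Wi}(n)=(n-1)^2+1$ for $n>1$. **Corollary (CSR decomposition).** Let $A\in\mathbb{R}_{\max}^{n\times n}$. Define $A_1=A$ and, as long as $\mathcal{D}(A_k)$ has a nonempty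 cycle, let $A_{k+1}$ be obtained from $A_k$ by setting to $-\infty$ all entries in the rows and columns of the nodes of $\mathcal{G}^c(A_k)$. This process stops after some number $K\le n$ of steps: $\mathcal{D}(A_1),\dots,\mathcal{D}(A_K)$ have nonempty cycles and $\mathcal{D}(A_{K+1})$ is acyclic ($K=0$ if $\mathcal{D}(A)$ is acyclic). For $1\le k\le K$ let $\lambda_k=\lambda(A_k)\in\mathbb{R}$, let $\mathcal{G}_k$ be any representing subgraph of $\mathcal{G}^c(A_k)$, and let $C_k,S_k,R_k$ be the CSR terms of $A_k$ with respect to $\mathcal{G}_k$. Then: 1. Each $S_k$ is diagonally similar to a Boolean matrix $P_k$ whose powers are ultimately periodic with period $\gamma(\mathcal{G}_k)\geq 1$. Moreover, for each $k$ the subgraph $\mathcal{G}_k$ can be chosen so that $P_k^{t+\gamma(\mathcal{G}_k)}=P_k^t$ for all $t\ge 1$. 2. For every integer $t\ge 0$ with $t\ge\min\bigl(\mathrm{Wi}(n),\,(n-2)\,\mathrm{cr}(\mathcal{D}(A))+n\bigr)$, $$A^t=\bigoplus_{k=1}^{K}\lambda_k^{\otimes t}\otimes C_kS_k^tR_k ,$$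 where an empty sum is the matrix with all entries $-\infty$. In the single case $n=1$, $A=(-\infty)$, the equality is claimed only for $t\ge 1$. -/

import Mathlib

noncomputable section

namespace MaxPlus

/-- The max-plus semiring `ℝ ∪ {-∞}`; addition is the maximum, multiplication is the usual
addition, the semiring zero is `-∞` and the semiring one is the real number `0`. -/
def Rmax : Type := WithBot ℝ

namespace Rmax

instance : ConditionallyCompleteLinearOrderBot Rmax :=
  inferInstanceAs (ConditionallyCompleteLinearOrderBot (WithBot ℝ))

/-- The embedding of the finite elements into the max-plus semiring. -/
def ofReal (x : ℝ) : Rmax := (WithBot.some x : WithBot ℝ)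

instance : Zero Rmax := ⟨⊥⟩
instance : One Rmax := ⟨ofReal 0⟩
instance : Add Rmax := ⟨fun a b => max a b⟩
instance : Mul Rmax := ⟨fun a b => (show WithBot ℝ from a) + (show WithBot ℝ from b)⟩

theorem add_def (a b : Rmax) : a + b = max a b := rfl
theorem mul_def (a b : Rmax) :
    a * b = ((show WithBot ℝ from a) + (show WithBot ℝ from b) : WithBot ℝ) := rfl
theorem zero_def : (0 : Rmax) = ⊥ := rfl
theorem one_def : (1 : Rmax) = ofReal 0 := rfl

theorem mul_add' (a b c : Rmax) : a * (b + c) = a * b + a * c :=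
  (max_add_add_left (α := WithBot ℝ) a b c).symm

theorem mul_comm' (a b : Rmax) : a * b = b * a := add_comm (G := WithBot ℝ) a b

instance : CommSemiring Rmax where
  add_assoc := max_assoc
  zero_add := bot_sup_eq
  add_zero := sup_bot_eq
  add_comm := max_comm
  nsmul := nsmulRec
  mul_assoc := add_assoc (G := WithBot ℝ)
  one_mul := zero_add (M := WithBot ℝ)
  mul_one := add_zero (M := WithBot ℝ)
  mul_comm := mul_comm'
  zero_mul := WithBot.bot_add (α := ℝ)
  mul_zero := WithBot.add_bot (α := ℝ)
  left_distrib := mul_add'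
  right_distrib := fun a b c => by rw [mul_comm', mul_add', mul_comm' c a, mul_comm' c b]

end Rmax

open Rmax

variable {n : ℕ}

/-! ### Digraphs, walks and cycles

A walk of length `L` is given by its nodes `w 0, …, w L`; the values of `w` beyond `L` are
irrelevant. The nodes of a subgraph are the endpoints of its edges. -/

/-- `w 0, …, w L` is a walk of length `L` in `G`. -/
def IsWalk (G : Digraph (Fin n)) (L : ℕ) (w : ℕ → Fin n) : Prop :=
  ∀ k < L, G.Adj (w k) (w (k + 1))

/-- A closed walk of length `L` (possibly empty). -/
def IsClosedWalk (G : Digraph (Fin n)) (L : ℕ) (w : ℕ → Fin n) : Prop :=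
  IsWalk G L w ∧ w L = w 0

/-- A nonempty (elementary) cycle of length `L`. -/
def IsCycle (G : Digraph (Fin n)) (L : ℕ) (w : ℕ → Fin n) : Prop :=
  0 < L ∧ IsClosedWalk G L w ∧ Set.InjOn w (Set.Iio L)

/-- `G` contains a nonempty cycle. -/
def HasCycle (G : Digraph (Fin n)) : Prop := ∃ L w, IsCycle G L w

/-- The greatest length of a cycle (`0` for an acyclic digraph). -/
def circumference (G : Digraph (Fin n)) : ℕ := sSup {L | ∃ w, IsCycle G L w}

/-- `i` is an endpoint of an edge of `G`. -/
def IsNode (G : Digraph (Fin n)) (i : Fin n) : Prop := ∃ j, G.Adj i j ∨ G.Adj j i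

/-- `i` and `j` are in the same strongly connected component of `G`. -/
def SameSCC (G : Digraph (Fin n)) (i j : Fin n) : Prop :=
  Relation.ReflTransGen G.Adj i j ∧ Relation.ReflTransGen G.Adj j i

/-- The cyclicity of the strongly connected component of `i` in `G`: the greatest common divisor
of the lengths of its closed walks. -/
def componentCyclicity (G : Digraph (Fin n)) (i : Fin n) : ℕ :=
  Nat.setGcd {L | ∃ w, IsClosedWalk G L w ∧ SameSCC G i (w 0)}

open Classical in
/-- The cyclicity of `G`: the least common multiple of the cyclicities of its strongly connected
components. -/
def cyclicity (G : Digraph (Fin n)) : ℕ :=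
  (Finset.univ.filter (IsNode G)).lcm (componentCyclicity G)

/-- There are no edges between distinct strongly connected components of `G`. -/
def IsCompletelyReducible (G : Digraph (Fin n)) : Prop :=
  ∀ i j, G.Adj i j → SameSCC G i j

/-- `G` is a completely reducible subgraph of `H`, and every strongly connected component of `H`
contains exactly one strongly connected component of `G`. -/
structure IsRepresenting (H G : Digraph (Fin n)) : Prop where
  le : G ≤ H
  completelyReducible : IsCompletelyReducible G
  exists_component : ∀ i, IsNode H i → ∃ j, IsNode G j ∧ SameSCC H i j
  unique_component : ∀ i j, IsNode G i → IsNode G j → SameSCC H i j → SameSCC G i j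

/-! ### Weighted digraph of a matrix, maximum cycle mean, critical graph -/

/-- The digraph of `A`: its edges are the positions of the entries different from `-∞`. -/
def digraph (A : Matrix (Fin n) (Fin n) Rmax) : Digraph (Fin n) := ⟨fun i j => A i j ≠ 0⟩

/-- The weight of a walk: the max-plus product (that is, the sum) of the weights of its edges. -/
def walkWeight (A : Matrix (Fin n) (Fin n) Rmax) (L : ℕ) (w : ℕ → Fin n) : Rmax :=
  ∏ k ∈ Finset.range L, A (w k) (w (k + 1))

/-- The maximum of weight divided by length over all nonempty cycles. It is used only if the
digraph of `A` has a cycle (otherwise the maximum cycle mean is `-∞`, and this value is junk). -/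
def maxCycleMean (A : Matrix (Fin n) (Fin n) Rmax) : ℝ :=
  sSup {x | ∃ L w, IsCycle (digraph A) L w ∧ walkWeight A L w = ofReal (L * x)}

/-- The critical graph: the edges of the nonempty closed walks whose mean weight is the maximum
cycle mean. -/
def criticalGraph (A : Matrix (Fin n) (Fin n) Rmax) : Digraph (Fin n) :=
  ⟨fun i j => ∃ L w, 0 < L ∧ IsClosedWalk (digraph A) L w ∧
    walkWeight A L w = ofReal (L * maxCycleMean A) ∧ ∃ k < L, w k = i ∧ w (k + 1) = j⟩

/-! ### CSR terms -/

/-- The Kleene star: the entrywise supremum of all powers `A ^ t`, `t ≥ 0`. -/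
def kleeneStar (A : Matrix (Fin n) (Fin n) Rmax) : Matrix (Fin n) (Fin n) Rmax :=
  fun i j => ⨆ t : ℕ, (A ^ t) i j

/-- `A` divided (in the max-plus sense) by its maximum cycle mean. -/
def normalized (A : Matrix (Fin n) (Fin n) Rmax) : Matrix (Fin n) (Fin n) Rmax :=
  ofReal (-maxCycleMean A) • A

/-- The matrix `M` from which the columns and rows of `C` and `R` are extracted. -/
def csrM (A : Matrix (Fin n) (Fin n) Rmax) (G : Digraph (Fin n)) :
    Matrix (Fin n) (Fin n) Rmax :=
  kleeneStar (normalized A ^ cyclicity G)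

open Classical in
def csrC (A : Matrix (Fin n) (Fin n) Rmax) (G : Digraph (Fin n)) :
    Matrix (Fin n) (Fin n) Rmax :=
  fun i j => if IsNode G j then csrM A G i j else 0

open Classical in
def csrS (A : Matrix (Fin n) (Fin n) Rmax) (G : Digraph (Fin n)) :
    Matrix (Fin n) (Fin n) Rmax :=
  fun i j => if G.Adj i j then normalized A i j else 0

open Classical in
def csrR (A : Matrix (Fin n) (Fin n) Rmax) (G : Digraph (Fin n)) :
    Matrix (Fin n) (Fin n) Rmax :=
  fun i j => if IsNode G i then csrM A G i j else 0

open Classical in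
/-- The subordinate matrix obtained by setting the rows and columns of all critical nodes to
`-∞` (Nachtigall scheme). -/
def nachtigall (A : Matrix (Fin n) (Fin n) Rmax) : Matrix (Fin n) (Fin n) Rmax :=
  fun i j => if IsNode (criticalGraph A) i ∨ IsNode (criticalGraph A) j then 0 else A i j

/-- The inductively defined matrices `A₀ = A` and `Aₖ₊₁ = nachtigall Aₖ`. -/
def reduced (A : Matrix (Fin n) (Fin n) Rmax) : ℕ → Matrix (Fin n) (Fin n) Rmax
  | 0 => A
  | k + 1 => nachtigall (reduced A k)

/-! ### Boolean matrices, diagonal similarity, the Wielandt number -/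

/-- All entries are `-∞` or `0` (the zero and the one of the max-plus semiring). -/
def IsBoolean (P : Matrix (Fin n) (Fin n) Rmax) : Prop := ∀ i j, P i j = 0 ∨ P i j = 1

/-- `P = D⁻ S D` for a diagonal matrix `D` with finite diagonal entries `d i`. -/
def DiagonallySimilar (S P : Matrix (Fin n) (Fin n) Rmax) : Prop :=
  ∃ d : Fin n → ℝ, P = Matrix.diagonal (fun i => ofReal (-d i)) * S *
    Matrix.diagonal (fun i => ofReal (d i))

/-- The powers `P ^ t` with `t ≥ T` are periodic with period `γ`. -/
def PeriodicFrom (P : Matrix (Fin n) (Fin n) Rmax) (T γ : ℕ) : Prop :=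
  0 < γ ∧ ∀ t ≥ T, P ^ (t + γ) = P ^ t

/-- The Wielandt number. -/
def wielandt (n : ℕ) : ℤ := if n = 1 then 0 else ((n : ℤ) - 1) ^ 2 + 1

end MaxPlus

end

/-! The entry of `A ^ t` at `(i, j)` is the greatest weight of a walk of length `t` from `i` to `j`.
A walk avoiding the critical nodes is a walk of `nachtigall A`; the others are governed by the CSR
term. This gives the one-step identity `pow_eq_csr_add`. Iterating it leaves a power of an acyclic
matrix, which vanishes for `t ≥ n`. The threshold is at least `n` unless `n = 1`, a case settled by
hand in `pow_eq_sum`.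

After normalization every closed walk has weight at most `1` (`closedLeOne_normalized`), and closed
walks in the critical graph have weight exactly `1` (`GWalk.csrS_closed`). So critical closed walks
can be inserted for free, and any closed subwalk can be deleted without loss.

That the CSR term dominates the critical walks (`HasWalk.le_csr`) needs no bound on `t`: critical
closed walks are inserted until the walk can be cut into a multiple of the cyclicity, then `t` steps
inside `G`, then another multiple. The converse `csr_le_pow` needs the threshold. An entry of the
CSR product comes from a walk through a node of `G` whose length is only congruent to `t`, and it
must be turned into a walk of length exactly `t` and no smaller weight. For this, fix an elementary
critical cycle of length `g`. A long walk contains `g` loops; by pigeonhole on partial sums, some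
nonempty subfamily has total length divisible by `g` and can be deleted. Repeating this brings the
length down to at most `t`, and copies of the cycle fill the gap. Counting loops separately before
and after the first visit to the cycle gives the bound `g (n - 2) + n` for `g < n`
(`HasWalk.le_pow_of_meets`). The Hamiltonian case `g = n` needs the structure of extremal zero-sum
free sequences to reach `(n - 1) ^ 2 + 1` (`HasWalk.le_pow_of_hamiltonian`).

For the Boolean form, the greatest weight of a walk starting at a node is a potential that turns all
critical edges into `1`. Period from `t = 1` on is obtained by choosing one elementary cycle in each
critical component. -/

noncomputable section

namespace MaxPlus

open Rmax

section

variable {n : ℕ}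

/-! ### The ordered semiring `Rmax` -/

namespace Rmax

instance : IsOrderedMonoid Rmax where
  mul_le_mul_left a b h c :=
    (inferInstance : IsOrderedAddMonoid (WithBot ℝ)).add_le_add_left a b h c

theorem zero_le' (a : Rmax) : 0 ≤ a := bot_le

theorem add_le_iff {a b c : Rmax} : a + b ≤ c ↔ a ≤ c ∧ b ≤ c := max_le_iff

theorem le_add_left' (a b : Rmax) : a ≤ a + b := le_max_left a b

theorem le_add_right' (a b : Rmax) : b ≤ a + b := le_max_right a b

theorem add_eq_or (a b : Rmax) : a + b = a ∨ a + b = b := max_choice a b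

theorem ofReal_ne_zero (r : ℝ) : ofReal r ≠ 0 := WithBot.coe_ne_bot

theorem exists_ofReal {x : Rmax} (h : x ≠ 0) : ∃ r, x = ofReal r :=
  let ⟨r, hr⟩ := WithBot.ne_bot_iff_exists.mp h
  ⟨r, hr.symm⟩

theorem ofReal_injective : Function.Injective ofReal := fun _ _ h => WithBot.coe_injective h

theorem ofReal_mul (a b : ℝ) : ofReal a * ofReal b = ofReal (a + b) := rfl

theorem ofReal_le {a b : ℝ} : ofReal a ≤ ofReal b ↔ a ≤ b := WithBot.coe_le_coe

theorem ofReal_pow (a : ℝ) (k : ℕ) : ofReal a ^ k = ofReal (k * a) := by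
  induction k with
  | zero => simp [one_def]
  | succ k ih => rw [pow_succ, ih, ofReal_mul]; congr 1; push_cast; ring

theorem ofReal_neg_mul (a : ℝ) : ofReal (-a) * ofReal a = 1 := by
  rw [ofReal_mul, neg_add_cancel, one_def]

instance : NoZeroDivisors Rmax where
  eq_zero_or_eq_zero_of_mul_eq_zero {_ _} h := WithBot.add_eq_bot.mp h

instance : Nontrivial Rmax := ⟨0, 1, (ofReal_ne_zero 0).symm⟩

theorem one_ne_zero' : (1 : Rmax) ≠ 0 := ofReal_ne_zero 0

theorem sum_le_iff {ι : Type*} {s : Finset ι} {f : ι → Rmax} {c : Rmax} :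
    ∑ i ∈ s, f i ≤ c ↔ ∀ i ∈ s, f i ≤ c := by
  classical
  induction s using Finset.induction_on with
  | empty => simp [zero_le']
  | insert a s ha ih => simp [Finset.sum_insert ha, add_le_iff, ih]

theorem le_sum {ι : Type*} {s : Finset ι} (f : ι → Rmax) {i : ι} (hi : i ∈ s) :
    f i ≤ ∑ i ∈ s, f i := sum_le_iff.mp le_rfl i hi

theorem exists_eq_sum {ι : Type*} {s : Finset ι} {f : ι → Rmax} (h : ∑ i ∈ s, f i ≠ 0) :
    ∃ i ∈ s, f i = ∑ i ∈ s, f i := by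
  classical
  induction s using Finset.induction_on with
  | empty => simp at h
  | insert a s ha ih =>
    rw [Finset.sum_insert ha] at h ⊢
    rcases add_eq_or (f a) (∑ i ∈ s, f i) with h' | h'
    · exact ⟨a, by simp, h'.symm⟩
    · rw [h'] at h ⊢
      obtain ⟨i, hi, e⟩ := ih h
      exact ⟨i, by simp [hi], e⟩

theorem eq_one_of_mul_eq_one {a b : Rmax} (h : a * b = 1) (hb : b ≤ 1) (ha : a ≤ 1) : a = 1 :=
  le_antisymm ha (by rw [← h]; exact mul_le_of_le_one_right' hb)

end Rmax

/-! ### Weighted walks and their visited nodes -/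

/-- There is a walk from `i` to `j` of length `L` and weight `x` whose set of visited nodes
is `S`. -/
inductive HasWalk (A : Matrix (Fin n) (Fin n) Rmax) :
    Fin n → Fin n → ℕ → Finset (Fin n) → Rmax → Prop
  | nil (i : Fin n) : HasWalk A i i 0 {i} 1
  | cons (i : Fin n) {j k : Fin n} {L : ℕ} {S : Finset (Fin n)} {x : Rmax} :
      HasWalk A j k L S x → HasWalk A i k (L + 1) (insert i S) (A i j * x)

namespace HasWalk

variable {A : Matrix (Fin n) (Fin n) Rmax} {i j k v : Fin n} {L L' : ℕ} {S S' : Finset (Fin n)}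
  {x x' : Rmax}

theorem start_mem (h : HasWalk A i j L S x) : i ∈ S := by
  cases h <;> simp

theorem end_mem (h : HasWalk A i j L S x) : j ∈ S := by
  induction h <;> simp_all

theorem card_le (h : HasWalk A i j L S x) : S.card ≤ L + 1 := by
  induction h with
  | nil => simp
  | cons i _ ih => exact (Finset.card_insert_le _ _).trans (by omega)

theorem append (h : HasWalk A i j L S x) (h' : HasWalk A j k L' S' x') :
    HasWalk A i k (L + L') (S ∪ S') (x * x') := by
  induction h with
  | nil => simpa [h'.start_mem] using h'
  | cons i _ ih =>
    have := (ih h').cons (A := A) i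
    rwa [← mul_assoc, ← Finset.insert_union, Nat.add_right_comm] at this

theorem single (A : Matrix (Fin n) (Fin n) Rmax) (i j : Fin n) :
    HasWalk A i j 1 {i, j} (A i j) := by
  simpa using (nil (A := A) j).cons i

/-- Splitting a walk after a given number of steps. -/
theorem split_at (h : HasWalk A i j (L + L') S x) : ∃ v S₁ S₂ x₁ x₂,
    HasWalk A i v L S₁ x₁ ∧ HasWalk A v j L' S₂ x₂ ∧ S = S₁ ∪ S₂ ∧ x = x₁ * x₂ := by
  induction L generalizing i S x with
  | zero =>
    rw [Nat.zero_add] at h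
    exact ⟨i, {i}, S, 1, x, nil i, h, by simp [h.start_mem], by simp⟩
  | succ L ih =>
    rw [Nat.add_right_comm] at h
    cases h with
    | cons _ h =>
      obtain ⟨v, S₁, S₂, x₁, x₂, h₁, h₂, rfl, rfl⟩ := ih h
      exact ⟨v, _, S₂, _, x₂, h₁.cons i, h₂, by simp, by rw [mul_assoc]⟩

/-- Splitting a walk at its first visit of a set of nodes. -/
theorem split_first (h : HasWalk A i j L S x) (Z : Finset (Fin n)) (hZ : ∃ v ∈ S, v ∈ Z) :
    ∃ v ∈ Z, ∃ L₁ L₂ S₁ S₂ x₁ x₂, HasWalk A i v L₁ S₁ x₁ ∧ HasWalk A v j L₂ S₂ x₂ ∧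
      L = L₁ + L₂ ∧ S = S₁ ∪ S₂ ∧ x = x₁ * x₂ ∧
      (L₁ = 0 ∨ ∃ u M T y, HasWalk A i u M T y ∧ Disjoint T Z ∧ L₁ = M + 1 ∧
        x₁ = y * A u v) := by
  induction h with
  | nil i =>
    obtain ⟨v, hv, hvZ⟩ := hZ
    obtain rfl := Finset.mem_singleton.mp hv
    exact ⟨v, hvZ, 0, 0, _, _, 1, 1, nil v, nil v, by simp, by simp, by simp, by simp⟩
  | cons i h ih =>
    by_cases hi : i ∈ Z
    · exact ⟨i, hi, 0, _, _, _, 1, _, nil i, h.cons i, by simp, by simp, by simp, by simp⟩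
    · obtain ⟨v, hvZ, L₁, L₂, S₁, S₂, x₁, x₂, h₁, h₂, rfl, rfl, rfl, h₃⟩ := ih (by
        obtain ⟨v, hv, hvZ⟩ := hZ
        refine ⟨v, (Finset.mem_insert.mp hv).resolve_left ?_, hvZ⟩
        rintro rfl; exact hi hvZ)
      refine ⟨v, hvZ, _, _, _, _, _, _, h₁.cons i, h₂, by omega, by simp, by rw [mul_assoc],
        Or.inr ?_⟩
      rcases h₃ with rfl | ⟨u, M, T, y, h₄, hd, rfl, rfl⟩
      · cases h₁ with
        | nil => exact ⟨i, 0, {i}, 1, nil i, by simpa using hi, rfl, by simp⟩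
      · exact ⟨u, _, _, _, h₄.cons i, by simp [hi, hd], rfl, by rw [mul_assoc]⟩

theorem split_node (h : HasWalk A i j L S x) (hv : v ∈ S) : ∃ L₁ L₂ S₁ S₂ x₁ x₂,
    HasWalk A i v L₁ S₁ x₁ ∧ HasWalk A v j L₂ S₂ x₂ ∧
      L = L₁ + L₂ ∧ S = S₁ ∪ S₂ ∧ x = x₁ * x₂ := by
  obtain ⟨u, hu, L₁, L₂, S₁, S₂, x₁, x₂, h₁, h₂, h₃, h₄, h₅, -⟩ :=
    h.split_first {v} ⟨v, hv, by simp⟩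
  obtain rfl := Finset.mem_singleton.mp hu
  exact ⟨L₁, L₂, S₁, S₂, x₁, x₂, h₁, h₂, h₃, h₄, h₅⟩

theorem rotate (h : HasWalk A v v L S x) (hi : i ∈ S) : HasWalk A i i L S x := by
  obtain ⟨L₁, L₂, S₁, S₂, x₁, x₂, h₁, h₂, rfl, rfl, rfl⟩ := h.split_node hi
  rw [add_comm, Finset.union_comm, mul_comm]
  exact h₂.append h₁

/-- Inserting a closed walk. -/
theorem insert_closed (h : HasWalk A i j L S x) (hv : v ∈ S) (h' : HasWalk A v v L' S' x') :
    HasWalk A i j (L + L') (S ∪ S') (x * x') := by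
  obtain ⟨L₁, L₂, S₁, S₂, x₁, x₂, h₁, h₂, rfl, rfl, rfl⟩ := h.split_node hv
  have := (h₁.append h').append h₂
  rwa [Nat.add_right_comm, mul_right_comm, Finset.union_right_comm] at this

theorem closed_pow (h : HasWalk A v v L S x) (m : ℕ) :
    ∃ T, HasWalk A v v (m * L) T (x ^ m) := by
  induction m with
  | zero => exact ⟨{v}, by simpa using nil v⟩
  | succ m ih =>
    obtain ⟨T, hT⟩ := ih
    exact ⟨_, by rw [Nat.succ_mul, pow_succ]; exact hT.append h⟩

theorem insert_closed_pow (h : HasWalk A i j L S x) (hv : v ∈ S) (h' : HasWalk A v v L' S' x')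
    (m : ℕ) : ∃ T, S ⊆ T ∧ HasWalk A i j (L + m * L') T (x * x' ^ m) := by
  obtain ⟨T, hT⟩ := h'.closed_pow m
  exact ⟨S ∪ T, Finset.subset_union_left, h.insert_closed hv hT⟩

theorem le_pow (h : HasWalk A i j L S x) : x ≤ (A ^ L) i j := by
  induction h with
  | nil => simp
  | @cons i j k L S x h ih =>
    rw [pow_succ', Matrix.mul_apply]
    exact (mul_le_mul_right ih _).trans (le_sum (fun v => A i v * (A ^ L) v k) (Finset.mem_univ j))

theorem exists_of_pow_ne_zero (h : (A ^ L) i j ≠ 0) : ∃ S, HasWalk A i j L S ((A ^ L) i j) := by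
  induction L generalizing i with
  | zero =>
    by_cases hij : i = j
    · subst hij; exact ⟨{i}, by simpa using nil i⟩
    · simp [hij] at h
  | succ L ih =>
    rw [pow_succ', Matrix.mul_apply] at h ⊢
    obtain ⟨v, -, hv⟩ := exists_eq_sum h
    obtain ⟨S, hS⟩ := ih (i := v) (by
      rintro h0
      rw [← hv, h0, mul_zero] at h
      exact h rfl)
    exact ⟨_, by rw [← hv]; exact hS.cons i⟩

/-- A bound on the weights of all walks of length `L` bounds the power. -/
theorem pow_le {c : Rmax} (h : ∀ S x, HasWalk A i j L S x → x ≠ 0 → x ≤ c) :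
    (A ^ L) i j ≤ c := by
  by_cases h0 : (A ^ L) i j = 0
  · rw [h0]; exact zero_le' c
  · obtain ⟨S, hS⟩ := exists_of_pow_ne_zero h0
    exact h S _ hS h0

theorem exists_fun (h : HasWalk A i j L S x) : ∃ w : ℕ → Fin n, w 0 = i ∧ w L = j ∧
    S = (Finset.range (L + 1)).image w ∧ walkWeight A L w = x := by
  induction h with
  | nil i => exact ⟨fun _ => i, rfl, rfl, by simp, by simp [walkWeight]⟩
  | @cons i j k L S x h ih =>
    obtain ⟨w, rfl, rfl, rfl, rfl⟩ := ih
    refine ⟨fun m => m.casesOn i w, rfl, rfl, ?_, ?_⟩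
    · ext v
      simp only [Finset.mem_insert, Finset.mem_image, Finset.mem_range]
      constructor
      · rintro (rfl | ⟨a, ha, rfl⟩)
        · exact ⟨0, by omega, rfl⟩
        · exact ⟨a + 1, by omega, rfl⟩
      · rintro ⟨a | a, ha, rfl⟩
        · exact Or.inl rfl
        · exact Or.inr ⟨a, by omega, rfl⟩
    · rw [walkWeight, Finset.prod_range_succ']
      exact mul_comm _ _

theorem of_fun (A : Matrix (Fin n) (Fin n) Rmax) (L : ℕ) (w : ℕ → Fin n) :
    HasWalk A (w 0) (w L) L ((Finset.range (L + 1)).image w) (walkWeight A L w) := by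
  induction L with
  | zero => simpa [walkWeight] using nil (w 0)
  | succ L ih =>
    have := ih.append (single A (w L) (w (L + 1)))
    rw [walkWeight, Finset.prod_range_succ]
    convert this using 1
    swap
    · rfl
    rw [Finset.range_add_one (n := L + 1), Finset.image_insert]
    ext v
    simp only [Finset.mem_insert, Finset.mem_union, Finset.mem_image, Finset.mem_range,
      Finset.mem_singleton]
    constructor
    · rintro (rfl | h)
      · exact Or.inr (Or.inr rfl)
      · exact Or.inl h
    · rintro (h | rfl | rfl)
      · tauto
      · exact Or.inr ⟨L, by omega, rfl⟩
      · tauto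

end HasWalk

theorem walkWeight_ne_zero_iff {A : Matrix (Fin n) (Fin n) Rmax} {L : ℕ} {w : ℕ → Fin n} :
    walkWeight A L w ≠ 0 ↔ IsWalk (digraph A) L w := by
  simp [walkWeight, Finset.prod_ne_zero_iff, IsWalk, digraph]

/-! ### Loop decompositions -/

/-- A nonempty elementary closed walk, given by its base node, its length and its weight. -/
def IsLoop (A : Matrix (Fin n) (Fin n) Rmax) (c : Fin n × ℕ × Rmax) : Prop :=
  0 < c.2.1 ∧ ∃ T, T.card = c.2.1 ∧ HasWalk A c.1 c.1 c.2.1 T c.2.2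

/-- A walk from `i` to `j` of length `L` and weight `x` obtained from a walk
visiting the nodes `S` by inserting the loops of `l` at visited nodes. -/
def HasLoops (A : Matrix (Fin n) (Fin n) Rmax) (i j : Fin n) (L : ℕ) (x : Rmax)
    (l : List (Fin n × ℕ × Rmax)) (S : Finset (Fin n)) : Prop :=
  ∃ L₀ x₀, HasWalk A i j L₀ S x₀ ∧ (∀ c ∈ l, IsLoop A c ∧ c.1 ∈ S) ∧
    L = L₀ + (l.map (·.2.1)).sum ∧ x = x₀ * (l.map (·.2.2)).prod

namespace HasLoops

variable {A : Matrix (Fin n) (Fin n) Rmax} {i j k v : Fin n} {L L' : ℕ} {S S' : Finset (Fin n)}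
  {x x' : Rmax} {l l' : List (Fin n × ℕ × Rmax)}

theorem of_hasWalk (h : HasWalk A i j L S x) : HasLoops A i j L x [] S :=
  ⟨L, x, h, by simp, by simp, by simp⟩

theorem append (h : HasLoops A i j L x l S) (h' : HasLoops A j k L' x' l' S') :
    HasLoops A i k (L + L') (x * x') (l ++ l') (S ∪ S') := by
  obtain ⟨L₀, x₀, hw, hl, rfl, rfl⟩ := h
  obtain ⟨L₀', x₀', hw', hl', rfl, rfl⟩ := h'
  refine ⟨_, _, hw.append hw', ?_, ?_, ?_⟩
  · intro c hc
    rcases List.mem_append.mp hc with hc | hc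
    · exact ⟨(hl c hc).1, Finset.mem_union_left _ (hl c hc).2⟩
    · exact ⟨(hl' c hc).1, Finset.mem_union_right _ (hl' c hc).2⟩
  · simp; omega
  · simp [mul_mul_mul_comm]

theorem exists_hasWalk (h : HasLoops A i j L x l S) : ∃ T, S ⊆ T ∧ HasWalk A i j L T x := by
  obtain ⟨L₀, x₀, hw, hl, rfl, rfl⟩ := h
  induction l with
  | nil => exact ⟨S, subset_rfl, by simpa using hw⟩
  | cons c l ih =>
    obtain ⟨T, hT, h⟩ := ih fun c hc => hl c (List.mem_cons_of_mem _ hc)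
    obtain ⟨⟨-, U, -, hU⟩, hS⟩ := hl c List.mem_cons_self
    refine ⟨T ∪ U, hT.trans Finset.subset_union_left, ?_⟩
    convert h.insert_closed (hT hS) hU using 1
    · simp; omega
    · simp [mul_comm, mul_left_comm]

theorem perm (h : HasLoops A i j L x l S) (hp : l.Perm l') : HasLoops A i j L x l' S := by
  obtain ⟨L₀, x₀, hw, hl, rfl, rfl⟩ := h
  exact ⟨L₀, x₀, hw, fun c hc => hl c (hp.mem_iff.mpr hc), by rw [(hp.map _).sum_eq],
    by rw [(hp.map _).prod_eq]⟩

end HasLoops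

/-- A walk that visits some node twice contains a loop. -/
theorem HasWalk.exists_loop {A : Matrix (Fin n) (Fin n) Rmax} {i j : Fin n} {L : ℕ}
    {S : Finset (Fin n)} {x : Rmax} (h : HasWalk A i j L S x) (hS : S.card ≤ L) :
    ∃ c T, HasLoops A i j L x [c] T := by
  induction h with
  | nil => simp at hS
  | @cons i j k L S x h ih =>
    by_cases hS' : S.card ≤ L
    · obtain ⟨c, T, hc⟩ := ih hS'
      have := (HasLoops.of_hasWalk (single A i j)).append hc
      rw [add_comm 1 L] at this
      exact ⟨c, _, this⟩
    · have hi : i ∈ S := by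
        by_contra hi
        rw [Finset.card_insert_of_notMem hi] at hS
        omega
      obtain ⟨L₁, L₂, S₁, S₂, x₁, x₂, h₁, h₂, rfl, rfl, rfl⟩ := h.split_node hi
      -- The tail visits `L + 1` distinct nodes, while `S₁` and `S₂` overlap in `i`; hence both
      -- bounds from `card_le` are equalities and the closed part is elementary.
      have hcard : S₁.card = L₁ + 1 := by
        have e := Finset.card_union_add_card_inter S₁ S₂
        have : 0 < (S₁ ∩ S₂).card :=
          Finset.card_pos.mpr ⟨i, Finset.mem_inter.mpr ⟨h₁.end_mem, h₂.start_mem⟩⟩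
        have := h₁.card_le
        have := h₂.card_le
        omega
      refine ⟨(i, L₁ + 1, A i j * x₁), S₂, L₂, x₂, h₂, ?_, ?_, ?_⟩
      · simp only [List.mem_singleton, forall_eq]
        refine ⟨⟨Nat.succ_pos _, _, hcard, ?_⟩, h₂.start_mem⟩
        simpa [h₁.end_mem] using h₁.cons i
      · simp; omega
      · simp [mul_comm, mul_left_comm]

/-- A walk of length at least `q * m` inside a set of `m` nodes contains `q` loops. -/
theorem HasWalk.exists_loops {A : Matrix (Fin n) (Fin n) Rmax} {i j : Fin n} {L : ℕ}
    {S : Finset (Fin n)} {x : Rmax} (h : HasWalk A i j L S x) {U : Finset (Fin n)} (hU : S ⊆ U)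
    {q : ℕ} (hq : q * U.card ≤ L) : ∃ l T, l.length = q ∧ HasLoops A i j L x l T := by
  induction q generalizing i L S x with
  | zero => exact ⟨[], S, rfl, .of_hasWalk h⟩
  | succ q ih =>
    rw [Nat.succ_mul, add_comm] at hq
    obtain ⟨L', rfl⟩ := Nat.exists_eq_add_of_le ((Nat.le_add_right _ _).trans hq)
    obtain ⟨v, S₁, S₂, x₁, x₂, h₁, h₂, rfl, rfl⟩ := h.split_at
    obtain ⟨c, T, hc⟩ := h₁.exists_loop
      (Finset.card_le_card (Finset.subset_union_left.trans hU))
    obtain ⟨l, T', hl, h'⟩ := ih h₂ (Finset.subset_union_right.trans hU) (by omega)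
    exact ⟨[c] ++ l, _, by simp [hl], hc.append h'⟩

end

section

variable {n : ℕ}

/-! ### Zero-sum subsequences -/

section ZeroSum

variable {α : Type*} {f : α → ℕ} {g : ℕ} {l : List α}

theorem exists_zeroSum_of_modEq {a b : ℕ} (hab : a < b) (hb : b ≤ l.length)
    (h : ((l.take a).map f).sum ≡ ((l.take b).map f).sum [MOD g]) :
    ∃ l' m, l.Perm (l' ++ m) ∧ l' ≠ [] ∧ g ∣ (l'.map f).sum := by
  have e : l.take b = l.take a ++ (l.take b).drop a := by
    conv_lhs => rw [← List.take_append_drop a (l.take b)]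
    rw [List.take_take, min_eq_left hab.le]
  refine ⟨(l.take b).drop a, l.take a ++ l.drop b, ?_, ?_, ?_⟩
  · conv_lhs => rw [← List.take_append_drop b l, e]
    rw [← List.append_assoc]
    exact List.perm_append_comm.append_right _
  · intro h0
    have := congrArg List.length h0
    simp at this
    omega
  · rw [e, List.map_append, List.sum_append] at h
    have := (Nat.modEq_iff_dvd' (Nat.le_add_right _ _)).mp h
    rwa [Nat.add_sub_cancel_left] at this

/-- Among the `g + 1` partial sums of the first terms two agree modulo `g`; the block between them
is the subsequence. -/
theorem exists_zeroSum (hg : 0 < g) (hl : g ≤ l.length) :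
    ∃ l' m, l.Perm (l' ++ m) ∧ l' ≠ [] ∧ g ∣ (l'.map f).sum := by
  obtain ⟨a, ha, b, hb, hne, h⟩ := Finset.exists_ne_map_eq_of_card_lt_of_maps_to
    (s := Finset.range (g + 1)) (t := Finset.range g)
    (f := fun k => ((l.take k).map f).sum % g) (by simp)
    (fun k _ => by simpa using Nat.mod_lt _ hg)
  simp only [Finset.mem_range] at ha hb
  rcases lt_or_gt_of_ne hne with hlt | hlt
  · exact exists_zeroSum_of_modEq hlt (by omega) h
  · exact exists_zeroSum_of_modEq hlt (by omega) h.symm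

/-- A zero-sum free sequence of length `g - 1` modulo `g` is constant. -/
theorem modEq_of_zeroSumFree (hl : l.length + 1 = g)
    (h : ∀ l' m, l.Perm (l' ++ m) → l' ≠ [] → ¬ g ∣ (l'.map f).sum) {a b : α} (ha : a ∈ l)
    (hb : b ∈ l) : f a ≡ f b [MOD g] := by
  classical
  by_contra hab
  have hba : b ≠ a := by rintro rfl; exact hab rfl
  obtain ⟨r₁, hr₁⟩ : ∃ r, l.Perm (a :: r) := ⟨_, List.perm_cons_erase ha⟩
  have hb' : b ∈ r₁ := (List.mem_cons.mp (hr₁.mem_iff.mp hb)).resolve_left hba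
  obtain ⟨r, hr⟩ : ∃ r, l.Perm (a :: b :: r) :=
    ⟨_, hr₁.trans ((List.perm_cons_erase hb').cons a)⟩
  have hlen := hr.length_eq
  have hinj : Set.InjOn (fun k => (((a :: b :: r).take k).map f).sum % g)
      (Finset.range g : Set ℕ) := by
    intro p hp q hq hpq
    simp only [Finset.coe_range, Set.mem_Iio] at hp hq
    by_contra hne
    have key : ∀ p q : ℕ, p < q → q < g →
        ¬ (((a :: b :: r).take p).map f).sum ≡ (((a :: b :: r).take q).map f).sum [MOD g] := by
      intro p q h1 h2 h3
      obtain ⟨l', m, h4, h5, h6⟩ := exists_zeroSum_of_modEq h1 (by omega) h3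
      exact h l' m (hr.trans h4) h5 h6
    rcases lt_or_gt_of_ne hne with hlt | hlt
    · exact key p q hlt hq hpq
    · exact key q p hlt hp hpq.symm
  have hg : 0 < g := by omega
  obtain ⟨k, hk, hkb⟩ := Finset.surjOn_of_injOn_of_card_le
    (fun k => (((a :: b :: r).take k).map f).sum % g) (s := Finset.range g) (t := Finset.range g)
    (fun k _ => by simpa using Nat.mod_lt _ hg) hinj le_rfl
    (show f b % g ∈ (Finset.range g : Set ℕ) by simpa using Nat.mod_lt _ hg)
  change _ ≡ _ [MOD g] at hkb
  rcases k with _ | _ | k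
  · refine h [b] (a :: r) (hr.trans (List.Perm.swap b a r)) (by simp) ?_
    simpa using (Nat.modEq_zero_iff_dvd.mp hkb.symm)
  · exact hab (by simpa using hkb)
  · refine h (a :: r.take k) (b :: r.drop k) (hr.trans ?_) (by simp) ?_
    · refine List.Perm.cons a ?_
      conv_lhs => rw [← List.take_append_drop k r]
      exact List.perm_middle.symm
    · simp only [List.take_succ_cons, List.map_cons, List.sum_cons] at hkb ⊢
      rw [add_left_comm] at hkb
      exact Nat.modEq_zero_iff_dvd.mp (Nat.ModEq.add_left_cancel' (f b) hkb)

end ZeroSum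

/-! ### Shortening walks modulo `g` -/

/-- All closed walks have weight at most `1`, that is, nonpositive weight. -/
def ClosedLeOne (A : Matrix (Fin n) (Fin n) Rmax) : Prop :=
  ∀ v L S x, HasWalk A v v L S x → x ≤ 1

variable {A : Matrix (Fin n) (Fin n) Rmax} {i j : Fin n} {L g t : ℕ} {S : Finset (Fin n)}
  {x : Rmax} {l : List (Fin n × ℕ × Rmax)}

/-- All loops hang on nodes of the same skeleton walk, so any subfamily can be dropped while the
nodes `S` stay visited. The dropped factors are at most `1`, so the weight does not decrease. -/
theorem HasLoops.remove (hA : ClosedLeOne A) (h : HasLoops A i j L x l S)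
    {l' m : List (Fin n × ℕ × Rmax)} (hp : l.Perm (l' ++ m)) (hl' : l' ≠ [])
    (hg : g ∣ (l'.map (·.2.1)).sum) :
    ∃ L' < L, L' ≡ L [MOD g] ∧ ∃ T x', S ⊆ T ∧ x ≤ x' ∧ HasWalk A i j L' T x' := by
  obtain ⟨L₀, x₀, hw, hl, rfl, rfl⟩ := h.perm hp
  have hm : HasLoops A i j _ _ m S :=
    ⟨L₀, x₀, hw, fun c hc => hl c (List.mem_append_right _ hc), rfl, rfl⟩
  obtain ⟨T, hT, hwT⟩ := hm.exists_hasWalk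
  refine ⟨_, ?_, ?_, T, _, hT, ?_, hwT⟩
  · obtain ⟨c, r, rfl⟩ := List.exists_cons_of_ne_nil hl'
    have := (hl c (by simp)).1.1
    simp
    omega
  · rw [List.map_append, List.sum_append]
    have := (Nat.modEq_zero_iff_dvd.mpr hg).symm
    simpa using ((this.add_right (m.map (·.2.1)).sum).add_left L₀)
  · rw [List.map_append, List.prod_append]
    refine mul_le_mul_right (mul_le_of_le_one_left' ?_) _
    refine (List.prod_le_pow_card _ 1 fun y hy => ?_).trans (one_pow _).le
    obtain ⟨c, hc, rfl⟩ := List.mem_map.mp hy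
    obtain ⟨-, T, -, hT⟩ := (hl c (List.mem_append_left _ hc)).1
    exact hA _ _ _ _ hT

theorem HasLoops.shorten (hA : ClosedLeOne A) (h : HasLoops A i j L x l S) (hg : 0 < g)
    (hl : g ≤ l.length) :
    ∃ L' < L, L' ≡ L [MOD g] ∧ ∃ T x', S ⊆ T ∧ x ≤ x' ∧ HasWalk A i j L' T x' := by
  obtain ⟨l', m, hp, hne, hd⟩ := exists_zeroSum (f := fun c : Fin n × ℕ × Rmax => c.2.1) hg hl
  exact h.remove hA hp hne hd

/-- Extending a walk through a node of a closed walk of weight `1`. -/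
theorem HasWalk.le_pow_of_le (h : HasWalk A i j L S x) {v : Fin n} (hv : v ∈ S)
    {Z : Finset (Fin n)} (hZ : HasWalk A v v g Z 1) (hL : L ≤ t) (hmod : L ≡ t [MOD g]) :
    x ≤ (A ^ t) i j := by
  obtain ⟨m, hm⟩ := (Nat.modEq_iff_dvd' hL).mp hmod
  obtain ⟨T, -, hT⟩ := h.insert_closed_pow hv hZ m
  have e : L + m * g = t := by rw [mul_comm m g]; omega
  rw [e, one_pow, mul_one] at hT
  exact hT.le_pow

/-- A walk meeting a cycle of weight `1` and length `g < n` can be replaced by a walk of any length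
`t ≥ g (n - 2) + n` in the same residue class. -/
theorem HasWalk.le_pow_of_meets (hA : ClosedLeOne A) {Z : Finset (Fin n)} (hg : 0 < g)
    (hgn : g < n) (hcard : Z.card = g) (hZ : ∀ v ∈ Z, HasWalk A v v g Z 1)
    (h : HasWalk A i j L S x) (hmeet : ∃ v ∈ S, v ∈ Z) (hmod : L ≡ t [MOD g])
    (ht : g * n + n ≤ t + 2 * g) : x ≤ (A ^ t) i j := by
  induction L using Nat.strong_induction_on generalizing S x with
  | _ L ih =>
  obtain ⟨v, hvZ, L₁, L₂, S₁, S₂, x₁, x₂, h₁, h₂, rfl, rfl, rfl, hfirst⟩ :=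
    h.split_first Z hmeet
  -- In this case the length is less than `t + g`; being congruent to `t` modulo `g`, it is at most
  -- `t`, and copies of the cycle fill the gap.
  by_cases hL : L₁ + L₂ + g + 1 ≤ g * n + n
  · refine h.le_pow_of_le (Finset.mem_union_left _ h₁.end_mem) (hZ v hvZ) ?_ hmod
    by_contra hlt
    obtain ⟨m, hm⟩ := (Nat.modEq_iff_dvd' (not_le.mp hlt).le).mp hmod.symm
    rcases m with _ | m
    · omega
    · rw [Nat.mul_succ] at hm
      omega
  have hc : (Finset.univ \ Z).card = n - g := by
    rw [Finset.card_sdiff_of_subset (Finset.subset_univ _), hcard, Finset.card_univ,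
      Fintype.card_fin]
  -- Before its last step the first part avoids `Z`, so it lives on `n - g` nodes and loops occur
  -- more often there.
  obtain ⟨p, l₁, T₁, hp, hl₁, hloops₁⟩ : ∃ p l₁ T₁, L₁ ≤ (p + 1) * (n - g) ∧
      l₁.length = p ∧ HasLoops A i v L₁ x₁ l₁ T₁ := by
    rcases hfirst with rfl | ⟨u, M, T, y, hu, hd, rfl, rfl⟩
    · exact ⟨0, [], S₁, by omega, rfl, .of_hasWalk h₁⟩
    · have hlt := Nat.lt_div_mul_add (a := M) (b := n - g) (by omega)
      obtain ⟨l, T', hl, h'⟩ := hu.exists_loops (U := Finset.univ \ Z)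
        (fun v hv => by simpa using Finset.disjoint_left.mp hd hv) (q := M / (n - g))
        (by rw [hc]; exact Nat.div_mul_le_self _ _)
      refine ⟨M / (n - g), l ++ [], _, ?_, by simp [hl], h'.append (.of_hasWalk (single A u v))⟩
      rw [Nat.succ_mul]; omega
  obtain ⟨l₂, T₂, hl₂, hloops₂⟩ := h₂.exists_loops (Finset.subset_univ S₂) (q := L₂ / n)
    (by simpa using Nat.div_mul_le_self _ _)
  have hq := Nat.lt_div_mul_add (a := L₂) (b := n) (by omega)
  -- With `q = L₂ / n` and `p + q < g`, the total length would be less than `(p + 1) (n - g) + (q +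
  -- 1) n ≤ (g + 1) n - g`, which is the case already treated.
  have hlen : g ≤ (l₁ ++ l₂).length := by
    rw [List.length_append, hl₁, hl₂]
    by_contra hlt
    obtain ⟨d, rfl⟩ : ∃ d, n = g + d := ⟨n - g, by omega⟩
    rw [Nat.add_sub_cancel_left] at hp
    have := Nat.mul_le_mul_right (g + d) (Nat.succ_le_of_lt (not_le.mp hlt))
    apply hL
    generalize L₂ / (g + d) = q at *
    nlinarith [Nat.zero_le (p * g)]
  obtain ⟨L', hlt, hmod', T, x', hT, hx, hw⟩ := (hloops₁.append hloops₂).shorten hA hg hlen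
  obtain ⟨_, _, hw₁, -⟩ := hloops₁
  exact hx.trans (ih L' hlt hw ⟨v, hT (Finset.mem_union_left _ hw₁.end_mem), hvZ⟩
    (hmod'.trans hmod))

/-- If there is a Hamiltonian cycle of weight `1`, then every walk can be replaced by a walk of
any length `t ≥ (n - 1) ^ 2 + 1` in the same residue class modulo `n`. -/
theorem HasWalk.le_pow_of_hamiltonian (hA : ClosedLeOne A) (hn : 2 ≤ n)
    (hZ : ∀ v, HasWalk A v v n Finset.univ 1)
    (h : HasWalk A i j L S x) (hmod : L ≡ t [MOD n])
    (ht : (n - 1) ^ 2 + 1 ≤ t) : x ≤ (A ^ t) i j := by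
  obtain ⟨m, rfl⟩ : ∃ m, n = m + 1 := ⟨n - 1, by omega⟩
  rw [Nat.add_sub_cancel] at ht
  induction L using Nat.strong_induction_on generalizing S x with
  | _ L ih =>
  -- Here `m = n - 1` and `t ≥ m ^ 2 + 1`, so such a length is at most `t + m`, and the congruence
  -- modulo `m + 1` forces it to be at most `t`.
  by_cases hL : L ≤ m ^ 2 + m + 1
  · refine h.le_pow_of_le h.start_mem (hZ i) ?_ hmod
    by_contra hlt
    obtain ⟨r, hr⟩ := (Nat.modEq_iff_dvd' (not_le.mp hlt).le).mp hmod.symm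
    rcases r with _ | r
    · omega
    · rw [Nat.mul_succ] at hr
      omega
  obtain ⟨l, T, hlen, hl⟩ := h.exists_loops (Finset.subset_univ S) (q := m)
    (by simp; nlinarith)
  by_cases hfree : ∀ l' r, l.Perm (l' ++ r) → l' ≠ [] → ¬ m + 1 ∣ (l'.map (·.2.1)).sum
  swap
  · push Not at hfree
    obtain ⟨l', r, hp, hne, hd⟩ := hfree
    obtain ⟨L', hlt, hmod', T, x', hT, hx, hw⟩ := hl.remove hA hp hne hd
    exact hx.trans (ih L' hlt hw (hmod'.trans hmod))
  obtain ⟨L₀, x₀, hw, hloop, hLeq, hxeq⟩ := hl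
  have hle : ∀ c ∈ l, c.2.1 ≤ m := by
    intro c hc
    obtain ⟨-, U, hU, -⟩ := (hloop c hc).1
    have h1 : U.card ≤ m + 1 := by simpa using Finset.card_le_univ U
    have h2 : c.2.1 ≠ m + 1 := fun h2 => hfree [c] (l.erase c) (List.perm_cons_erase hc)
      (by simp) (by simp [h2])
    omega
  -- The `n - 1` loops form an extremal zero-sum free sequence modulo `n`, so their lengths are
  -- congruent, and they are all less than `n`.
  have hconst : ∀ c ∈ l, ∀ c' ∈ l, c.2.1 = c'.2.1 := fun c hc c' hc' =>
    Nat.ModEq.eq_of_lt_of_lt (modEq_of_zeroSumFree (by rw [hlen]) hfree hc hc')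
      (Nat.lt_succ_of_le (hle c hc)) (Nat.lt_succ_of_le (hle c' hc'))
  obtain ⟨c, hc, hmax⟩ : ∃ c ∈ l, ∀ c' ∈ l, c'.2.2 ≤ c.2.2 := by
    have hne : l.toFinset.Nonempty := by
      rw [List.toFinset_nonempty_iff, ← List.length_pos_iff]; omega
    obtain ⟨c, hc, h⟩ := l.toFinset.exists_max_image (fun c => c.2.2) hne
    exact ⟨c, by simpa using hc, fun c' hc' => h c' (by simpa using hc')⟩
  have hsum : (l.map (·.2.1)).sum = m * c.2.1 := by
    rw [List.sum_eq_card_nsmul _ c.2.1, List.length_map, hlen, smul_eq_mul]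
    intro y hy
    obtain ⟨c', hc', rfl⟩ := List.mem_map.mp hy
    exact hconst c' hc' c hc
  have hprod : (l.map (·.2.2)).prod ≤ c.2.2 ^ m := by
    have := List.prod_le_pow_card (l.map (·.2.2)) c.2.2 (by
      intro y hy
      obtain ⟨c', hc', rfl⟩ := List.mem_map.mp hy
      exact hmax c' hc')
    rwa [List.length_map, hlen] at this
  obtain ⟨⟨hpos, U, hU, hUw⟩, hcT⟩ := hloop c hc
  obtain ⟨v, hvU, L₁, L₂, S₁, S₂, x₁, x₂, h₁, h₂, rfl, rfl, rfl, hfirst⟩ :=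
    hw.split_first U ⟨c.1, hcT, hUw.start_mem⟩
  -- Since the loops have equal length, all can be replaced by copies of the heaviest one, based at
  -- the node `v` it shares with the skeleton. One further loop in the skeleton then yields `n`
  -- loops, enough to shorten.
  have finish : ∀ {l₁ l₂ T₁ T₂}, HasLoops A i v L₁ x₁ l₁ T₁ → HasLoops A v j L₂ x₂ l₂ T₂ →
      1 ≤ l₁.length + l₂.length → x ≤ (A ^ t) i j := by
    intro l₁ l₂ T₁ T₂ hl₁ hl₂ hpos'
    have hmid : HasLoops A v v (m * c.2.1) (c.2.2 ^ m)
        (List.replicate m (v, c.2.1, c.2.2)) {v} := by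
      refine ⟨0, 1, .nil v, ?_, by simp, by simp⟩
      intro c' hc'
      rw [List.eq_of_mem_replicate hc']
      exact ⟨⟨hpos, U, hU, hUw.rotate hvU⟩, by simp⟩
    have hall := (hl₁.append hmid).append hl₂
    obtain ⟨L', hlt, hmod', T, x', hT, hx, hw⟩ := hall.shorten hA (Nat.succ_pos m)
      (by simp only [List.length_append, List.length_replicate]; omega)
    have e : L₁ + m * c.2.1 + L₂ = L := by rw [hLeq, hsum]; omega
    rw [e] at hlt hmod'
    refine le_trans ?_ (hx.trans (ih L' hlt hw (hmod'.trans hmod)))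
    rw [hxeq, mul_right_comm x₁ _ x₂]
    exact mul_le_mul_right hprod _
  have hcU := hle c hc
  by_cases hL₂ : m + 1 ≤ L₂
  · obtain ⟨c', T', h'⟩ := h₂.exists_loop (le_trans (by simpa using Finset.card_le_univ S₂) hL₂)
    exact finish (.of_hasWalk h₁) h' (by simp)
  by_cases hL₁ : L₁ ≤ m + 1 - c.2.1
  -- If neither part is long enough to contain a loop, then with `a` the common loop length, `L ≤ m
  -- a + (m + 1 - a) + m`, which is at most `m ^ 2 + m + 1` because `a ≤ m`.
  · exfalso
    apply hL
    rw [hLeq, hsum]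
    generalize c.2.1 = a at *
    obtain ⟨d, hd⟩ : ∃ d, m = a + d := ⟨m - a, by omega⟩
    have : m ^ 2 = m * a + m * d := by rw [sq, ← mul_add, ← hd]
    have : d ≤ m * d := Nat.le_mul_of_pos_left d (by omega)
    omega
  · rcases hfirst with rfl | ⟨u, M, W, y, hu, hd, rfl, rfl⟩
    · omega
    · have hW : W.card ≤ M := by
        have := Finset.card_union_of_disjoint hd
        have := Finset.card_le_univ (W ∪ U)
        simp only [Fintype.card_fin] at this
        omega
      obtain ⟨c', T', h'⟩ := hu.exists_loop hW
      exact finish (h'.append (.of_hasWalk (single A u v))) (.of_hasWalk h₂) (by simp)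

end

section

variable {n : ℕ} {A B : Matrix (Fin n) (Fin n) Rmax} {G : Digraph (Fin n)}
  {i j k : Fin n} {L t : ℕ} {S : Finset (Fin n)} {x : Rmax}

/-! ### The Kleene star -/

/-- Deleting loops never lowers the weight, so walks shorter than `n` suffice. This bounds the
family of powers and makes the supremum in `kleeneStar` an attained maximum. -/
theorem ClosedLeOne.exists_lt (hB : ClosedLeOne B) (h : HasWalk B i j L S x) :
    ∃ s < n, x ≤ (B ^ s) i j := by
  induction L using Nat.strong_induction_on generalizing S x with
  | _ L ih =>
  by_cases hL : L < n
  · exact ⟨L, hL, h.le_pow⟩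
  obtain ⟨c, T, L₀, x₀, hw, hc, rfl, rfl⟩ := h.exists_loop
    (le_trans (by simpa using Finset.card_le_univ S) (not_lt.mp hL))
  obtain ⟨⟨hpos, U, -, hU⟩, -⟩ := hc c (by simp)
  obtain ⟨s, hs, hle⟩ := ih L₀ (by simp [hpos]) hw
  exact ⟨s, hs, (mul_le_of_le_one_right' (by simpa using hB _ _ _ _ hU)).trans hle⟩

theorem ClosedLeOne.pow_le_sum (hB : ClosedLeOne B) (s : ℕ) (i j : Fin n) :
    (B ^ s) i j ≤ ∑ s ∈ Finset.range n, (B ^ s) i j := by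
  refine HasWalk.pow_le fun S x h _ => ?_
  obtain ⟨r, hr, hle⟩ := hB.exists_lt h
  exact hle.trans (le_sum (fun s => (B ^ s) i j) (Finset.mem_range.mpr hr))

theorem ClosedLeOne.pow_le_kleeneStar (hB : ClosedLeOne B) (s : ℕ) (i j : Fin n) :
    (B ^ s) i j ≤ kleeneStar B i j :=
  le_ciSup (f := fun s => (B ^ s) i j)
    ⟨_, by rintro _ ⟨s, rfl⟩; exact hB.pow_le_sum s i j⟩ s

theorem ClosedLeOne.exists_eq_kleeneStar (hB : ClosedLeOne B) (i j : Fin n) :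
    ∃ s, kleeneStar B i j = (B ^ s) i j := by
  have hle : kleeneStar B i j ≤ ∑ s ∈ Finset.range n, (B ^ s) i j :=
    ciSup_le' fun s => hB.pow_le_sum s i j
  by_cases h0 : ∑ s ∈ Finset.range n, (B ^ s) i j = 0
  · exact ⟨0, le_antisymm (hle.trans (by rw [h0]; exact zero_le' _)) (hB.pow_le_kleeneStar 0 i j)⟩
  · obtain ⟨s, -, hs⟩ := exists_eq_sum h0
    exact ⟨s, le_antisymm (hle.trans hs.ge) (hB.pow_le_kleeneStar s i j)⟩

theorem ClosedLeOne.pow (hB : ClosedLeOne B) (m : ℕ) : ClosedLeOne (B ^ m) := by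
  intro v L S x h
  refine h.le_pow.trans ?_
  rw [← pow_mul]
  exact HasWalk.pow_le fun S x h _ => hB _ _ _ _ h

/-! ### Cycles and the maximum cycle mean -/

theorem HasWalk.isCycle (h : HasWalk A i i L S x) (hL : 0 < L) (hS : S.card = L) (hx : x ≠ 0) :
    ∃ w, IsCycle (digraph A) L w ∧ w 0 = i ∧ walkWeight A L w = x := by
  obtain ⟨w, h0, hend, rfl, rfl⟩ := h.exists_fun
  refine ⟨w, ⟨hL, ⟨walkWeight_ne_zero_iff.mp hx, hend.trans h0.symm⟩, ?_⟩, h0, rfl⟩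
  have : (Finset.range (L + 1)).image w = (Finset.range L).image w := by
    rw [Finset.range_add_one, Finset.image_insert, Finset.insert_eq_self, hend, ← h0]
    exact Finset.mem_image_of_mem w (by simpa using hL)
  rw [this] at hS
  have := Finset.card_image_iff.mp (hS.trans (Finset.card_range L).symm)
  simpa using this

theorem IsCycle.length_le {w : ℕ → Fin n} (h : IsCycle G L w) : L ≤ n := by
  have := Finset.card_le_univ ((Finset.range L).image w)
  rwa [Finset.card_image_of_injOn (by simpa using h.2.2), Finset.card_range, Fintype.card_fin]
    at this

theorem IsCycle.le_circumference {w : ℕ → Fin n} (h : IsCycle G L w) : L ≤ circumference G :=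
  le_csSup ⟨n, by rintro _ ⟨w, hw⟩; exact hw.length_le⟩ ⟨w, h⟩

theorem circumference_mono {G G' : Digraph (Fin n)} (h : ∀ i j, G.Adj i j → G'.Adj i j) :
    circumference G ≤ circumference G' := by
  by_cases hG : {L | ∃ w, IsCycle G L w}.Nonempty
  · refine csSup_le hG ?_
    rintro L ⟨w, hL, ⟨hw, he⟩, hi⟩
    exact IsCycle.le_circumference ⟨hL, ⟨fun k hk => h _ _ (hw k hk), he⟩, hi⟩
  · rw [circumference, Set.not_nonempty_iff_eq_empty.mp hG, csSup_empty]
    exact bot_le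

/-- A cycle has at most `n` edges, so its mean depends only on its length and on `n + 1` nodes.
Finiteness makes the real supremum in `maxCycleMean` an upper bound and, if there is a cycle, an
attained one. -/
theorem finite_cycleMeans (A : Matrix (Fin n) (Fin n) Rmax) :
    {x | ∃ L w, IsCycle (digraph A) L w ∧ walkWeight A L w = ofReal (L * x)}.Finite := by
  refine (Set.finite_range fun p : Fin (n + 1) × (Fin (n + 1) → Fin n) =>
    Function.invFun ofReal (walkWeight A p.1 fun m => p.2 (Fin.ofNat (n + 1) m)) /
      (p.1 : ℝ)).subset ?_
  rintro x ⟨L, w, hc, hx⟩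
  have hL := hc.length_le
  refine ⟨(⟨L, by omega⟩, fun m => w m), ?_⟩
  have e : (walkWeight A L fun m => w (Fin.ofNat (n + 1) m)) = walkWeight A L w := by
    refine Finset.prod_congr rfl fun m hm => ?_
    have := Finset.mem_range.mp hm
    simp only [Fin.val_ofNat]
    rw [Nat.mod_eq_of_lt (by omega), Nat.mod_eq_of_lt (by omega)]
  simp only [e, hx, Function.leftInverse_invFun ofReal_injective _]
  exact mul_div_cancel_left₀ x (Nat.cast_ne_zero.mpr hc.1.ne')

theorem HasWalk.smul (c : Rmax) (h : HasWalk A i j L S x) :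
    HasWalk (c • A) i j L S (c ^ L * x) := by
  induction h with
  | nil => simpa using HasWalk.nil _
  | @cons i j k L S x h ih =>
    have := ih.cons i
    rwa [Matrix.smul_apply, smul_eq_mul, mul_mul_mul_comm, ← pow_succ'] at this

theorem smul_normalized (A : Matrix (Fin n) (Fin n) Rmax) :
    ofReal (maxCycleMean A) • normalized A = A := by
  rw [normalized, smul_smul, mul_comm, ofReal_neg_mul, one_smul]

theorem digraph_normalized (A : Matrix (Fin n) (Fin n) Rmax) :
    digraph (normalized A) = digraph A := by
  simp [digraph, normalized, ofReal_ne_zero]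

theorem pow_eq_smul_normalized (A : Matrix (Fin n) (Fin n) Rmax) (t : ℕ) :
    A ^ t = ofReal (maxCycleMean A) ^ t • normalized A ^ t := by
  conv_lhs => rw [← smul_normalized A, smul_pow]

theorem exists_ofReal_mul {x : Rmax} (h : x ≠ 0) (hL : 0 < L) : ∃ r : ℝ, x = ofReal (L * r) := by
  obtain ⟨r, rfl⟩ := exists_ofReal h
  exact ⟨r / L, by rw [mul_div_cancel₀ r (Nat.cast_ne_zero.mpr hL.ne')]⟩

/-- A nonempty closed walk is elementary or contains a loop besides its first step. -/
theorem HasWalk.closed_cases (h : HasWalk A i i (L + 1) S x) :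
    S.card = L + 1 ∨ ∃ L₀ < L, ∃ T x₀ c, HasWalk A i i (L₀ + 1) T x₀ ∧ IsLoop A c ∧
      x = x₀ * c.2.2 := by
  cases h with
  | @cons i j _ _ S x h =>
    by_cases hS : S.card ≤ L
    · obtain ⟨c, T, L₀, x₀, hw, hc, rfl, rfl⟩ := h.exists_loop hS
      have hc := (hc c (by simp)).1
      refine Or.inr ⟨L₀, ?_, _, _, c, hw.cons i, hc, by simp [mul_assoc]⟩
      simpa using hc.1
    · left
      rw [Finset.insert_eq_self.mpr h.end_mem]
      have := h.card_le
      omega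

theorem closedLeOne_of_loops (h : ∀ c, IsLoop A c → c.2.2 ≤ 1) : ClosedLeOne A := by
  intro v L S x hw
  induction L using Nat.strong_induction_on generalizing S x with
  | _ L ih =>
  rcases L with _ | L
  · cases hw; exact le_rfl
  rcases hw.closed_cases with hS | ⟨L₀, hL₀, T, x₀, c, hw', hc, rfl⟩
  · exact h (v, L + 1, x) ⟨Nat.succ_pos _, S, hS, hw⟩
  · exact mul_le_one' (ih _ (by omega) _ _ hw') (h c hc)

/-- Weights of walks with respect to `A` and to its normalization. -/
theorem HasWalk.of_normalized (h : HasWalk (normalized A) i j L S x) :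
    HasWalk A i j L S (ofReal (maxCycleMean A) ^ L * x) := by
  simpa [smul_normalized] using h.smul (ofReal (maxCycleMean A))

theorem HasWalk.normalized (h : HasWalk A i j L S x) :
    HasWalk (normalized A) i j L S (ofReal (-maxCycleMean A) ^ L * x) :=
  h.smul _

theorem closedLeOne_normalized (A : Matrix (Fin n) (Fin n) Rmax) :
    ClosedLeOne (normalized A) := by
  refine closedLeOne_of_loops ?_
  rintro ⟨v, L, x⟩ ⟨hL, S, hS, h⟩
  dsimp only at hL hS h ⊢
  by_cases hx : x = 0
  · rw [hx]; exact zero_le' 1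
  obtain ⟨r, rfl⟩ := exists_ofReal_mul hx hL
  obtain ⟨w, hw, -, hwx⟩ := h.of_normalized.isCycle hL hS
    (mul_ne_zero (pow_ne_zero _ (ofReal_ne_zero _)) hx)
  have hle : maxCycleMean A + r ≤ maxCycleMean A :=
    le_csSup (finite_cycleMeans A).bddAbove ⟨L, w, hw, by
      rw [hwx, ofReal_pow, ofReal_mul, mul_add]⟩
  rw [one_def, ofReal_le]
  exact mul_nonpos_of_nonneg_of_nonpos (Nat.cast_nonneg _) (by linarith)

theorem exists_isCycle_mean (h : HasCycle (digraph A)) :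
    ∃ L w, IsCycle (digraph A) L w ∧ walkWeight A L w = ofReal (L * maxCycleMean A) := by
  obtain ⟨L, w, hw⟩ := h
  obtain ⟨r, hr⟩ := exists_ofReal_mul (walkWeight_ne_zero_iff.mpr hw.2.1.1) hw.1
  have hne : {x | ∃ L w, IsCycle (digraph A) L w ∧ walkWeight A L w = ofReal (L * x)}.Nonempty :=
    ⟨r, L, w, hw, hr⟩
  exact hne.csSup_mem (finite_cycleMeans A)

theorem exists_isNode_criticalGraph (h : HasCycle (digraph A)) :
    ∃ i, IsNode (criticalGraph A) i := by
  obtain ⟨L, w, hw, hx⟩ := exists_isCycle_mean h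
  exact ⟨w 0, w 1, Or.inl ⟨L, w, hw.1, hw.2.1, hx, 0, hw.1, rfl, rfl⟩⟩

/-- An edge is critical if and only if it lies on a closed walk of normalized weight `1`. -/
theorem criticalGraph_adj_iff : (criticalGraph A).Adj i j ↔
    ∃ L S y, HasWalk (normalized A) j i L S y ∧ normalized A i j * y = 1 := by
  constructor
  · rintro ⟨L, w, hL, ⟨hw, hend⟩, hx, m, hm, rfl, rfl⟩
    obtain ⟨r, rfl⟩ : ∃ r, L = m + 1 + r := ⟨L - (m + 1), by omega⟩
    have h₁ := HasWalk.of_fun A m w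
    have h₂ := HasWalk.of_fun A r fun q => w (m + 1 + q)
    have h₃ := (h₂.append (by simp only [hend]; exact h₁)).normalized
    refine ⟨_, _, _, h₃, ?_⟩
    have hx' : walkWeight A m w * A (w m) (w (m + 1)) *
        walkWeight A r (fun q => w (m + 1 + q)) =
          ofReal ((m + 1 + r : ℕ) * maxCycleMean A) := by
      rw [← hx, walkWeight, walkWeight, walkWeight, Finset.prod_range_add,
        Finset.prod_range_succ]
      rfl
    rw [MaxPlus.normalized, Matrix.smul_apply, smul_eq_mul]
    calc _ = ofReal (-maxCycleMean A) ^ (r + m + 1) * (walkWeight A m w * A (w m) (w (m + 1)) *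
        walkWeight A r (fun q => w (m + 1 + q))) := by rw [pow_succ]; ac_rfl
      _ = 1 := by
        rw [hx', ofReal_pow, ofReal_mul, one_def]
        congr 1
        push_cast
        ring
  · rintro ⟨L, S, y, h, hy⟩
    obtain ⟨w, rfl, rfl, -, hwy⟩ := h.of_normalized.exists_fun
    have hA : A (w L) (w 0) = ofReal (maxCycleMean A) * normalized A (w L) (w 0) := by
      conv_lhs => rw [← smul_normalized A]
      rfl
    have hw : walkWeight A (L + 1) (fun m => m.casesOn (w L) w) =
        ofReal ((L + 1 : ℕ) * maxCycleMean A) := by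
      rw [walkWeight, Finset.prod_range_succ']
      change walkWeight A L w * A (w L) (w 0) = _
      rw [hwy, hA, mul_mul_mul_comm, mul_comm y, hy, mul_one, ← pow_succ, ofReal_pow]
    exact ⟨L + 1, fun m => m.casesOn (w L) w, Nat.succ_pos _,
      ⟨walkWeight_ne_zero_iff.mp (by rw [hw]; exact ofReal_ne_zero _), rfl⟩, hw,
      0, Nat.succ_pos _, rfl, rfl⟩

end

section

variable {n : ℕ} {A B : Matrix (Fin n) (Fin n) Rmax} {G H : Digraph (Fin n)}
  {i j k v : Fin n} {L L' t : ℕ} {S S' : Finset (Fin n)} {x : Rmax}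

/-! ### Walks in digraphs and cyclicity -/

open Classical in
/-- The Boolean adjacency matrix of a digraph. -/
def boolMatrix (G : Digraph (Fin n)) : Matrix (Fin n) (Fin n) Rmax :=
  fun i j => if G.Adj i j then 1 else 0

theorem isBoolean_boolMatrix (G : Digraph (Fin n)) : IsBoolean (boolMatrix G) := by
  intro i j
  unfold boolMatrix
  split_ifs <;> simp

theorem boolMatrix_of_adj (h : G.Adj i j) : boolMatrix G i j = 1 := if_pos h

theorem adj_of_boolMatrix_ne_zero (h : boolMatrix G i j ≠ 0) : G.Adj i j := by
  by_contra h0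
  exact h (if_neg h0)

theorem digraph_boolMatrix (G : Digraph (Fin n)) : digraph (boolMatrix G) = G := by
  ext i j
  exact ⟨adj_of_boolMatrix_ne_zero, fun h => by
    change boolMatrix G i j ≠ 0
    rw [boolMatrix_of_adj h]; exact one_ne_zero'⟩

theorem HasWalk.eq_one_of_boolMatrix (h : HasWalk (boolMatrix G) i j L S x) (hx : x ≠ 0) :
    x = 1 := by
  induction h with
  | nil => rfl
  | @cons i j k L S x h ih =>
    rw [ih (right_ne_zero_of_mul hx), boolMatrix_of_adj (adj_of_boolMatrix_ne_zero
      (left_ne_zero_of_mul hx)), one_mul]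

/-- There is a walk in `G` from `i` to `j` of length `L` whose set of visited nodes is `S`. -/
def GWalk (G : Digraph (Fin n)) (i j : Fin n) (L : ℕ) (S : Finset (Fin n)) : Prop :=
  HasWalk (boolMatrix G) i j L S 1

namespace GWalk

theorem nil (G : Digraph (Fin n)) (i : Fin n) : GWalk G i i 0 {i} := HasWalk.nil i

theorem cons (h : G.Adj i j) (h' : GWalk G j k L S) : GWalk G i k (L + 1) (insert i S) := by
  have := HasWalk.cons i h'
  rwa [boolMatrix_of_adj h, one_mul] at this

theorem single (h : G.Adj i j) : GWalk G i j 1 {i, j} := by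
  simpa using (nil G j).cons h

theorem append (h : GWalk G i j L S) (h' : GWalk G j k L' S') :
    GWalk G i k (L + L') (S ∪ S') := by
  have := HasWalk.append h h'
  rwa [one_mul] at this

theorem of_hasWalk (h : HasWalk (boolMatrix G) i j L S x) (hx : x ≠ 0) : GWalk G i j L S := by
  have := h.eq_one_of_boolMatrix hx
  subst this
  exact h

/-- Induction on walks from the first step. -/
theorem induction {motive : Fin n → ℕ → Finset (Fin n) → Prop} (hnil : motive k 0 {k})
    (hcons : ∀ i j L S, G.Adj i j → GWalk G j k L S → motive j L S →
      motive i (L + 1) (insert i S)) (h : GWalk G i k L S) : motive i L S := by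
  suffices H : ∀ {i k L S x}, HasWalk (boolMatrix G) i k L S x → x ≠ 0 →
      ∀ motive : Fin n → ℕ → Finset (Fin n) → Prop, motive k 0 {k} →
      (∀ i j L S, G.Adj i j → GWalk G j k L S → motive j L S →
        motive i (L + 1) (insert i S)) → motive i L S from
    H h one_ne_zero' motive hnil hcons
  intro i k L S x h hx motive hnil hcons
  induction h with
  | nil => exact hnil
  | @cons i j k L S x h ih =>
    exact hcons i j L S (adj_of_boolMatrix_ne_zero (left_ne_zero_of_mul hx))
      (of_hasWalk h (right_ne_zero_of_mul hx)) (ih (right_ne_zero_of_mul hx) hnil hcons)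

theorem of_isWalk {w : ℕ → Fin n} (h : IsWalk G L w) :
    GWalk G (w 0) (w L) L ((Finset.range (L + 1)).image w) := by
  refine of_hasWalk (HasWalk.of_fun (boolMatrix G) L w) (walkWeight_ne_zero_iff.mpr ?_)
  rwa [digraph_boolMatrix]

theorem exists_isWalk (h : GWalk G i j L S) :
    ∃ w, IsWalk G L w ∧ w 0 = i ∧ w L = j ∧ S = (Finset.range (L + 1)).image w := by
  obtain ⟨w, h0, hL, hS, hw⟩ := HasWalk.exists_fun h
  have := walkWeight_ne_zero_iff.mp (hw.trans_ne one_ne_zero')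
  rw [digraph_boolMatrix] at this
  exact ⟨w, this, h0, hL, hS⟩

theorem of_reflTransGen (h : Relation.ReflTransGen G.Adj i j) : ∃ L S, GWalk G i j L S := by
  induction h using Relation.ReflTransGen.head_induction_on with
  | refl => exact ⟨0, _, nil G j⟩
  | head ha _ ih =>
    obtain ⟨L, S, h⟩ := ih
    exact ⟨_, _, h.cons ha⟩

theorem isNode_end (h : GWalk G i j L S) (hi : IsNode G i) : IsNode G j := by
  refine h.induction (motive := fun i _ _ => IsNode G i → IsNode G j) id ?_ hi
  exact fun i j _ _ ha _ ih _ => ih ⟨i, Or.inr ha⟩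

theorem componentCyclicity_dvd (h : GWalk G k k L S) : componentCyclicity G k ∣ L := by
  obtain ⟨w, hw, h0, hL, -⟩ := h.exists_isWalk
  exact Nat.setGcd_dvd_of_mem ⟨w, ⟨hw, hL.trans h0.symm⟩, by rw [h0]; exact ⟨.refl, .refl⟩⟩

end GWalk

theorem IsWalk.reflTransGen {w : ℕ → Fin n} (h : IsWalk G L w) {p q : ℕ} (hpq : p ≤ q)
    (hq : q ≤ L) : Relation.ReflTransGen G.Adj (w p) (w q) := by
  induction q, hpq using Nat.le_induction with
  | base => exact .refl
  | succ q _ ih => exact (ih (by omega)).tail (h q (by omega))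

theorem IsClosedWalk.reflTransGen {w : ℕ → Fin n} (h : IsClosedWalk G L w) {p q : ℕ}
    (hp : p ≤ L) (hq : q ≤ L) : Relation.ReflTransGen G.Adj (w p) (w q) := by
  have h₁ := h.1.reflTransGen hp le_rfl
  rw [h.2] at h₁
  exact h₁.trans (h.1.reflTransGen (Nat.zero_le q) hq)

/-- All large multiples of the cyclicity of a component are lengths of closed walks at any of its
nodes. -/
theorem exists_closed_of_ge (G : Digraph (Fin n)) (k : Fin n) :
    ∃ N, ∀ m ≥ N, componentCyclicity G k ∣ m → ∃ S, GWalk G k k m S := by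
  obtain ⟨N, hN⟩ := Nat.exists_mem_closure_of_ge (s := {L | ∃ S, GWalk G k k L S})
  refine ⟨N, fun m hm hd => ?_⟩
  -- A closed walk of length `L` elsewhere in the component is reached from `k` by a round trip; the
  -- round trips with and without it differ in length by `L`.
  have hdvd : Nat.setGcd {L | ∃ S, GWalk G k k L S} ∣ componentCyclicity G k := by
    refine Nat.dvd_setGcd_iff.mpr ?_
    rintro L ⟨w, ⟨hw, hend⟩, hto, hfrom⟩
    obtain ⟨a, S₁, h₁⟩ := GWalk.of_reflTransGen hto
    obtain ⟨b, S₂, h₂⟩ := GWalk.of_reflTransGen hfrom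
    have h₃ := GWalk.of_isWalk hw
    rw [hend] at h₃
    have d₁ := Nat.setGcd_dvd_of_mem (s := {L | ∃ S, GWalk G k k L S}) ⟨_, h₁.append h₂⟩
    have d₂ := Nat.setGcd_dvd_of_mem (s := {L | ∃ S, GWalk G k k L S})
      ⟨_, (h₁.append h₃).append h₂⟩
    rw [Nat.add_right_comm] at d₂
    exact (Nat.dvd_add_right d₁).mp d₂
  have := hN m hm (hdvd.trans hd)
  refine AddSubmonoid.closure_induction (fun _ h => h) ⟨_, GWalk.nil G k⟩ ?_ this
  rintro a b - - ⟨S₁, h₁⟩ ⟨S₂, h₂⟩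
  exact ⟨_, h₁.append h₂⟩

theorem IsCompletelyReducible.exists_closed (hG : IsCompletelyReducible G) (hk : IsNode G k) :
    ∃ L S, GWalk G k k (L + 1) S := by
  obtain ⟨j, hj | hj⟩ := hk
  · obtain ⟨L, S, h⟩ := GWalk.of_reflTransGen (hG _ _ hj).2
    exact ⟨L, _, h.cons hj⟩
  · obtain ⟨L, S, h⟩ := GWalk.of_reflTransGen (hG _ _ hj).2
    exact ⟨L, _, h.append (.single hj)⟩

/-- Every node of a completely reducible digraph lies on an elementary cycle. -/
theorem IsCompletelyReducible.exists_elementary (hG : IsCompletelyReducible G)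
    (hk : IsNode G k) : ∃ g S, 0 < g ∧ S.card = g ∧ GWalk G k k g S := by
  classical
  have hex := hG.exists_closed hk
  -- A shortest nonempty closed walk at `k` is elementary, since deleting a loop away from its first
  -- step would leave a shorter nonempty one.
  obtain ⟨S, h⟩ := Nat.find_spec hex
  refine ⟨_, S, Nat.succ_pos _, ?_, h⟩
  rcases HasWalk.closed_cases h with hS | ⟨L₀, hL₀, T, x₀, c, hw, hc, he⟩
  · exact hS
  · refine absurd ?_ (Nat.find_min hex hL₀)
    refine ⟨T, GWalk.of_hasWalk hw ?_⟩
    rintro rfl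
    rw [zero_mul] at he
    exact one_ne_zero' he

theorem componentCyclicity_dvd_cyclicity (hk : IsNode G k) :
    componentCyclicity G k ∣ cyclicity G :=
  Finset.dvd_lcm (by simpa using hk)

theorem IsCompletelyReducible.cyclicity_pos (hG : IsCompletelyReducible G) :
    0 < cyclicity G := by
  rw [Nat.pos_iff_ne_zero, cyclicity, Ne, Finset.lcm_eq_zero_iff]
  rintro ⟨k, hk, h0⟩
  have hk : IsNode G k := by simpa using hk
  obtain ⟨L, S, h⟩ := hG.exists_closed hk
  have := h.componentCyclicity_dvd
  rw [h0] at this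
  exact Nat.succ_ne_zero _ (Nat.zero_dvd.mp this)

/-! ### Critical walks -/

theorem csrS_of_adj (h : G.Adj i j) : csrS A G i j = normalized A i j := if_pos h

theorem adj_of_csrS_ne_zero (h : csrS A G i j ≠ 0) : G.Adj i j := by
  by_contra h0
  exact h (if_neg h0)

theorem HasWalk.of_csrS (h : HasWalk (csrS A G) i j L S x) (hx : x ≠ 0) :
    GWalk G i j L S ∧ HasWalk (MaxPlus.normalized A) i j L S x := by
  induction h with
  | nil i => exact ⟨.nil G i, .nil i⟩
  | @cons i j k L S x h ih =>
    have ha := adj_of_csrS_ne_zero (left_ne_zero_of_mul hx)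
    obtain ⟨h₁, h₂⟩ := ih (right_ne_zero_of_mul hx)
    rw [csrS_of_adj ha]
    exact ⟨h₁.cons ha, h₂.cons i⟩

/-- Walks in the critical graph can be continued to closed walks of weight `1`. -/
theorem GWalk.exists_return (hG : G ≤ criticalGraph A) (h : GWalk G i j L S) :
    ∃ x, HasWalk (csrS A G) i j L S x ∧ ∃ L' S' y, HasWalk (normalized A) j i L' S' y ∧
      x * y = 1 := by
  refine h.induction (motive := fun i L S => ∃ x, HasWalk (csrS A G) i j L S x ∧
    ∃ L' S' y, HasWalk (normalized A) j i L' S' y ∧ x * y = 1)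
    ⟨1, .nil j, 0, _, 1, .nil j, one_mul 1⟩ ?_
  rintro i k L S ha - ⟨x, hx, L', S', y, hy, hxy⟩
  obtain ⟨M, T, z, hz, hiz⟩ := criticalGraph_adj_iff.mp (hG ha)
  refine ⟨_, hx.cons i, _, _, _, hy.append hz, ?_⟩
  rw [csrS_of_adj ha, mul_assoc, ← mul_assoc x, hxy, one_mul, hiz]

/-- The closed walk and its return walk are both closed, hence of weight at most `1`, and their
product is `1`. -/
theorem GWalk.csrS_closed (hG : G ≤ criticalGraph A) (h : GWalk G k k L S) :
    HasWalk (csrS A G) k k L S 1 := by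
  obtain ⟨x, hx, L', S', y, hy, hxy⟩ := h.exists_return hG
  have hx0 : x ≠ 0 := left_ne_zero_of_mul (hxy.trans_ne one_ne_zero')
  have : x = 1 := eq_one_of_mul_eq_one hxy (closedLeOne_normalized A _ _ _ _ hy)
    (closedLeOne_normalized A _ _ _ _ (hx.of_csrS hx0).2)
  rwa [← this]

theorem GWalk.normalized_closed (hG : G ≤ criticalGraph A) (h : GWalk G k k L S) :
    HasWalk (normalized A) k k L S 1 :=
  ((h.csrS_closed hG).of_csrS one_ne_zero').2

theorem isCompletelyReducible_criticalGraph (A : Matrix (Fin n) (Fin n) Rmax) :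
    IsCompletelyReducible (criticalGraph A) := by
  intro i j h
  refine ⟨.single h, ?_⟩
  obtain ⟨L, w, hL, ⟨hw, hend⟩, hx, m, hm, rfl, rfl⟩ := h
  have hcl : IsClosedWalk (criticalGraph A) L w :=
    ⟨fun q hq => ⟨L, w, hL, ⟨hw, hend⟩, hx, q, hq, rfl, rfl⟩, hend⟩
  exact hcl.reflTransGen hm hm.le

/-- A walk through a node of a completely reducible critical subgraph `G` can be replaced by a walk
of any sufficiently large length in the same residue class modulo the cyclicity of `G`. -/
theorem HasWalk.le_pow_of_critical (hG : G ≤ criticalGraph A) (hred : IsCompletelyReducible G)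
    (hk : IsNode G k) (h : HasWalk (MaxPlus.normalized A) i j L S x) (hkS : k ∈ S)
    (hmod : L ≡ t [MOD cyclicity G])
    (ht : min (wielandt n) (((n : ℤ) - 2) * circumference (digraph A) + n) ≤ t) :
    x ≤ (MaxPlus.normalized A ^ t) i j := by
  have hA := closedLeOne_normalized A
  obtain ⟨g, Z, hg, hcard, hZ⟩ := hred.exists_elementary hk
  have hZN := hZ.normalized_closed hG
  have hgn : g ≤ n := by simpa [hcard] using Finset.card_le_univ Z
  have hgc : g ≤ circumference (digraph A) := by
    obtain ⟨w, hw, -⟩ := hZN.isCycle hg hcard one_ne_zero'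
    rw [digraph_normalized] at hw
    exact hw.le_circumference
  -- The congruence modulo the cyclicity is upgraded to one modulo `g`, at the price of a longer
  -- walk, by inserting at `k` a long closed walk of `G` of length congruent to `t - L` modulo `g`.
  obtain ⟨M, T, hT, hw, hM⟩ : ∃ M T, S ⊆ T ∧ HasWalk (MaxPlus.normalized A) i j M T x ∧
      M ≡ t [MOD g] := by
    obtain ⟨N, hN⟩ := exists_closed_of_ge G k
    have hle : L + N ≤ g * (L + N) := Nat.le_mul_of_pos_left _ hg
    obtain ⟨U, hU⟩ := hN (t + g * (L + N) - L) (by omega) (by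
      refine (Nat.modEq_iff_dvd' (by omega)).mp ?_
      have h₁ := hmod.of_dvd (componentCyclicity_dvd_cyclicity hk)
      have h₂ := (Nat.modEq_zero_iff_dvd.mpr
        (hZ.componentCyclicity_dvd.mul_right (L + N))).symm
      exact h₁.add h₂)
    refine ⟨_, _, Finset.subset_union_left,
      by simpa using h.insert_closed hkS (hU.normalized_closed hG), ?_⟩
    rw [show L + (t + g * (L + N) - L) = t + g * (L + N) by omega]
    exact Nat.add_mul_mod_self_left t g _
  rcases hgn.lt_or_eq with hlt | rfl
  · refine hw.le_pow_of_meets hA hg hlt hcard (fun v hv => hZN.rotate hv)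
      ⟨k, hT hkS, hZN.start_mem⟩ hM ?_
    -- Both terms of the minimum dominate: `g` is at most the circumference, and `g ≤ n - 1` gives
    -- at most `(n - 2) (n - 1) + n = (n - 1) ^ 2 + 1`.
    have h1 : ((n : ℤ) - 2) * g + n ≤ t := by
      have hn : (2 : ℤ) ≤ n := by omega
      refine le_trans (le_min ?_ ?_) ht
      · rw [wielandt, if_neg (by omega)]
        have : (g : ℤ) ≤ n - 1 := by omega
        nlinarith
      · have : (g : ℤ) ≤ circumference (digraph A) := by exact_mod_cast hgc
        nlinarith
    zify
    nlinarith
  · have hZu : Z = Finset.univ := Finset.eq_univ_of_card Z (by simpa using hcard)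
    subst hZu
    by_cases hn : g = 1
    · subst hn
      obtain rfl := Subsingleton.elim i j
      refine (hA _ _ _ _ hw).trans ?_
      exact (HasWalk.nil i).le_pow_of_le (by simp) (hZN.rotate (Finset.mem_univ i))
        (Nat.zero_le _) (Nat.modEq_one)
    · refine hw.le_pow_of_hamiltonian hA (by omega) (fun v => hZN.rotate (Finset.mem_univ v)) hM ?_
      have h1 : ((g : ℤ) - 1) ^ 2 + 1 ≤ t := by
        refine le_trans (le_min ?_ ?_) ht
        · rw [wielandt, if_neg hn]
        · have : (g : ℤ) ≤ circumference (digraph A) := by exact_mod_cast hgc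
          have : (2 : ℤ) ≤ g := by omega
          nlinarith
      zify
      rwa [Nat.cast_sub (by omega), Nat.cast_one]

/-! ### The CSR product -/

theorem csr_le_pow (hG : G ≤ criticalGraph A) (hred : IsCompletelyReducible G)
    (ht : min (wielandt n) (((n : ℤ) - 2) * circumference (digraph A) + n) ≤ t) :
    (csrC A G * csrS A G ^ t * csrR A G) i j ≤ (normalized A ^ t) i j := by
  have hB := (closedLeOne_normalized A).pow (cyclicity G)
  rw [Matrix.mul_apply, sum_le_iff]
  intro v _
  rw [Matrix.mul_apply, Finset.sum_mul, sum_le_iff]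
  intro u _
  by_cases h0 : csrC A G i u * (csrS A G ^ t) u v * csrR A G v j = 0
  · rw [h0]; exact zero_le' _
  have hC0 := left_ne_zero_of_mul (left_ne_zero_of_mul h0)
  have hS0 := right_ne_zero_of_mul (left_ne_zero_of_mul h0)
  have hR0 := right_ne_zero_of_mul h0
  have hu : IsNode G u := by by_contra hu; exact hC0 (if_neg hu)
  have hv : IsNode G v := by by_contra hv; exact hR0 (if_neg hv)
  have hC : csrC A G i u = kleeneStar (normalized A ^ cyclicity G) i u := if_pos hu
  have hR : csrR A G v j = kleeneStar (normalized A ^ cyclicity G) v j := if_pos hv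
  obtain ⟨a, ha⟩ := hB.exists_eq_kleeneStar i u
  obtain ⟨b, hb⟩ := hB.exists_eq_kleeneStar v j
  rw [← pow_mul] at ha hb
  rw [hC, ha] at hC0 ⊢
  rw [hR, hb] at hR0 ⊢
  obtain ⟨S₁, h₁⟩ := HasWalk.exists_of_pow_ne_zero hC0
  obtain ⟨S₂, h₂⟩ := HasWalk.exists_of_pow_ne_zero hS0
  obtain ⟨S₃, h₃⟩ := HasWalk.exists_of_pow_ne_zero hR0
  refine ((h₁.append (h₂.of_csrS hS0).2).append h₃).le_pow_of_critical hG hred hu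
    (by simp [h₁.end_mem]) ?_ ht
  have e : cyclicity G * a + t + cyclicity G * b = t + cyclicity G * (a + b) := by ring
  rw [e]
  exact Nat.add_mul_mod_self_left t _ _

theorem HasWalk.le_csr (hG : IsRepresenting (criticalGraph A) G)
    (h : HasWalk (MaxPlus.normalized A) i j t S x) (hv : IsNode (criticalGraph A) v)
    (hvS : v ∈ S) : x ≤ (csrC A G * csrS A G ^ t * csrR A G) i j := by
  have hB := (closedLeOne_normalized A).pow (cyclicity G)
  have hγ := hG.completelyReducible.cyclicity_pos
  obtain ⟨k, hk, hto, hfrom⟩ := hG.exists_component v hv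
  obtain ⟨a, S₁, h₁⟩ := GWalk.of_reflTransGen hto
  obtain ⟨b, S₂, h₂⟩ := GWalk.of_reflTransGen hfrom
  -- The node `v` need not lie in `G`. Making a critical round trip from `v` to a node `k` of `G` as
  -- many times as the cyclicity keeps the length in its residue class.
  obtain ⟨d, T, hT, hw⟩ : ∃ d T, k ∈ T ∧
      HasWalk (MaxPlus.normalized A) i j (t + cyclicity G * d) T x := by
    have hc := (h₁.append h₂).normalized_closed le_rfl
    have hw := h.insert_closed hvS hc
    obtain ⟨T, hT, hw⟩ := hw.insert_closed_pow (Finset.mem_union_left _ hvS) hc (cyclicity G - 1)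
    refine ⟨a + b, T, hT ?_, ?_⟩
    · simp [HasWalk.end_mem h₁]
    · rw [one_pow, mul_one, mul_one] at hw
      convert hw using 1
      obtain ⟨m, hm⟩ : ∃ m, cyclicity G = m + 1 := ⟨cyclicity G - 1, by omega⟩
      rw [hm, Nat.add_sub_cancel]
      ring
  obtain ⟨p, q, T₁, T₂, x₁, x₂, hw₁, hw₂, hpq, rfl, rfl⟩ := hw.split_node hT
  obtain ⟨c, U, hc⟩ := hG.completelyReducible.exists_closed hk
  -- A closed walk of `G` at `k`, with length a multiple of the cyclicity, is cut into three pieces: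
  -- `p * (cyclicity G - 1)` steps complete the `p` steps before `k` to a multiple, `t` steps feed
  -- `S ^ t`, and the `r` remaining steps plus `q` are then also a multiple.
  obtain ⟨r, hr⟩ : ∃ r, (cyclicity G * (p * (cyclicity G - 1) + t)) * (c + 1) =
      p * (cyclicity G - 1) + (t + r) := by
    have : p * (cyclicity G - 1) + t ≤ cyclicity G * (p * (cyclicity G - 1) + t) :=
      Nat.le_mul_of_pos_left _ hγ
    have := Nat.le_mul_of_pos_right (cyclicity G * (p * (cyclicity G - 1) + t))
      (Nat.lt_add_one_of_le (Nat.zero_le c))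
    exact ⟨_, by rw [← Nat.add_assoc]; exact (Nat.add_sub_cancel' (by omega)).symm⟩
  obtain ⟨V, hV⟩ := (hc.csrS_closed hG.le).closed_pow (cyclicity G * (p * (cyclicity G - 1) + t))
  rw [one_pow, hr] at hV
  obtain ⟨u, V₁, V', y₁, y', hy₁, hy', -, hyy'⟩ := hV.split_at
  obtain ⟨w, V₂, V₃, y₂, y₃, hy₂, hy₃, -, rfl⟩ := hy'.split_at
  have hy0 := hyy'.symm.trans_ne one_ne_zero'
  have hy₁0 := left_ne_zero_of_mul hy0
  have hy₂0 := left_ne_zero_of_mul (right_ne_zero_of_mul hy0)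
  have hy₃0 := right_ne_zero_of_mul (right_ne_zero_of_mul hy0)
  have hu : IsNode G u := (hy₁.of_csrS hy₁0).1.isNode_end hk
  have hw : IsNode G w := (hy₂.of_csrS hy₂0).1.isNode_end hu
  have hγ' : p + p * (cyclicity G - 1) = cyclicity G * p := by
    obtain ⟨m, hm⟩ : ∃ m, cyclicity G = m + 1 := ⟨cyclicity G - 1, by omega⟩
    rw [hm, Nat.add_sub_cancel]
    ring
  have hC : x₁ * y₁ ≤ csrC A G i u := by
    have := (hw₁.append (hy₁.of_csrS hy₁0).2).le_pow
    rw [hγ', pow_mul] at this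
    exact (this.trans (hB.pow_le_kleeneStar _ _ _)).trans_eq (if_pos hu).symm
  have hR : y₃ * x₂ ≤ csrR A G w j := by
    obtain ⟨m, hm⟩ : cyclicity G ∣ r + q := by
      have e : cyclicity G * p + (r + q) =
          cyclicity G * ((p * (cyclicity G - 1) + t) * (c + 1) + d) := by
        rw [mul_add (cyclicity G), ← mul_assoc]
        omega
      exact (Nat.dvd_add_right (Dvd.intro p rfl)).mp ⟨_, e⟩
    have := ((hy₃.of_csrS hy₃0).2.append hw₂).le_pow
    rw [hm, pow_mul] at this
    exact (this.trans (hB.pow_le_kleeneStar _ _ _)).trans_eq (if_pos hw).symm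
  calc x₁ * x₂ = x₁ * y₁ * y₂ * (y₃ * x₂) := by
        rw [← mul_one (x₁ * x₂), hyy']; ac_rfl
    _ ≤ csrC A G i u * (csrS A G ^ t) u w * csrR A G w j :=
        mul_le_mul' (mul_le_mul' hC hy₂.le_pow) hR
    _ ≤ (csrC A G * csrS A G ^ t) i w * csrR A G w j := by
        refine mul_le_mul_left ?_ _
        rw [Matrix.mul_apply]
        exact le_sum (fun u => csrC A G i u * (csrS A G ^ t) u w) (Finset.mem_univ u)
    _ ≤ _ := by
        rw [Matrix.mul_apply]
        exact le_sum (fun w => (csrC A G * csrS A G ^ t) i w * csrR A G w j) (Finset.mem_univ w)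

end

section

variable {n : ℕ} {A B : Matrix (Fin n) (Fin n) Rmax} {G H : Digraph (Fin n)}
  {i j k v : Fin n} {L L' t : ℕ} {S S' : Finset (Fin n)} {x : Rmax}

/-! ### Boolean form of `S` -/

/-- The potential of a node: the greatest weight of a walk of length less than `n` from it. -/
def potential (B : Matrix (Fin n) (Fin n) Rmax) (i : Fin n) : Rmax :=
  ∑ k, ∑ s ∈ Finset.range n, (B ^ s) i k

theorem potential_ne_zero (B : Matrix (Fin n) (Fin n) Rmax) (i : Fin n) : potential B i ≠ 0 := by
  have hn : 0 ∈ Finset.range n := Finset.mem_range.mpr i.pos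
  have h : (1 : Rmax) ≤ potential B i := calc
    (1 : Rmax) = (B ^ 0) i i := by simp
    _ ≤ ∑ s ∈ Finset.range n, (B ^ s) i i := le_sum (fun s => (B ^ s) i i) hn
    _ ≤ potential B i :=
      le_sum (fun k => ∑ s ∈ Finset.range n, (B ^ s) i k) (Finset.mem_univ i)
  intro h0
  rw [h0] at h
  exact one_ne_zero' (le_antisymm h (zero_le' 1))

theorem HasWalk.mul_potential_le (hB : ClosedLeOne B) (h : HasWalk B i j L S x) :
    x * potential B j ≤ potential B i := by
  rw [potential, Finset.mul_sum, sum_le_iff]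
  intro k hk
  rw [Finset.mul_sum, sum_le_iff]
  intro s _
  calc x * (B ^ s) j k ≤ (B ^ L) i j * (B ^ s) j k := mul_le_mul_left h.le_pow _
    _ ≤ (B ^ (L + s)) i k := by
      rw [pow_add, Matrix.mul_apply]
      exact le_sum (fun j => (B ^ L) i j * (B ^ s) j k) (Finset.mem_univ j)
    _ ≤ _ := hB.pow_le_sum _ i k
    _ ≤ potential B i := le_sum (fun k => ∑ s ∈ Finset.range n, (B ^ s) i k) hk

/-- On a critical edge the potential inequality is an equality: the return walk supplies the reverse
inequality. -/
theorem diagonallySimilar_boolMatrix (hG : G ≤ criticalGraph A) :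
    DiagonallySimilar (csrS A G) (boolMatrix G) := by
  have hA := closedLeOne_normalized A
  choose d hd using fun i => exists_ofReal (potential_ne_zero (normalized A) i)
  refine ⟨d, ?_⟩
  ext i j
  rw [Matrix.mul_diagonal, Matrix.diagonal_mul]
  by_cases h : G.Adj i j
  · obtain ⟨L, S, y, hy, hij⟩ := criticalGraph_adj_iff.mp (hG h)
    have h₁ := (HasWalk.single (normalized A) i j).mul_potential_le hA
    have h₂ : potential (normalized A) i ≤ normalized A i j * potential (normalized A) j := by
      have := mul_le_mul_right (hy.mul_potential_le hA) (normalized A i j)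
      rwa [← mul_assoc, hij, one_mul] at this
    rw [boolMatrix_of_adj h, csrS_of_adj h, mul_assoc, ← hd, le_antisymm h₁ h₂, hd,
      ofReal_neg_mul]
  · rw [csrS, if_neg h, boolMatrix, if_neg h, mul_zero, zero_mul]

/-! ### Periodicity of Boolean matrices -/

theorem boolMatrix_pow_eq {t t' : ℕ}
    (h : ∀ i j, (∃ S, GWalk G i j t S) ↔ ∃ S, GWalk G i j t' S) :
    boolMatrix G ^ t = boolMatrix G ^ t' := by
  have key : ∀ t t' : ℕ, (∀ i j, (∃ S, GWalk G i j t S) → ∃ S, GWalk G i j t' S) →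
      ∀ i j, (boolMatrix G ^ t) i j ≤ (boolMatrix G ^ t') i j := by
    intro t t' h i j
    refine HasWalk.pow_le fun S x hw hx => ?_
    obtain ⟨T, hT⟩ := h i j ⟨S, .of_hasWalk hw hx⟩
    rw [hw.eq_one_of_boolMatrix hx]
    exact HasWalk.le_pow hT
  ext i j
  exact le_antisymm (key t t' (fun i j => (h i j).mp) i j)
    (key t' t (fun i j => (h i j).mpr) i j)

theorem GWalk.isNode_start (h : GWalk G i j L S) (hL : L ≠ 0) : IsNode G i :=
  h.induction (motive := fun i L _ => L ≠ 0 → IsNode G i) (fun h => absurd rfl h)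
    (fun _ j _ _ ha _ _ _ => ⟨j, Or.inl ha⟩) hL

theorem IsCompletelyReducible.exists_return (hG : IsCompletelyReducible G)
    (h : GWalk G i j L S) : ∃ L' S', GWalk G j i L' S' := by
  refine GWalk.of_reflTransGen (h.induction
    (motive := fun i _ _ => Relation.ReflTransGen G.Adj j i) .refl ?_)
  exact fun _ _ _ _ ha _ ih => ih.trans (hG _ _ ha).2

theorem IsCompletelyReducible.exists_periodicFrom (hG : IsCompletelyReducible G) :
    ∃ T, PeriodicFrom (boolMatrix G) T (cyclicity G) := by
  have key : ∀ i j, ∀ᶠ t in Filter.atTop,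
      ((∃ S, GWalk G i j (t + cyclicity G) S) ↔ ∃ S, GWalk G i j t S) := by
    intro i j
    by_cases hex : ∃ a S, GWalk G i j a S
    swap
    · push Not at hex
      exact Filter.Eventually.of_forall fun t =>
        ⟨fun ⟨S, h⟩ => absurd h (hex _ S), fun ⟨S, h⟩ => absurd h (hex _ S)⟩
    obtain ⟨a, U, ha⟩ := hex
    obtain ⟨b, V, hb⟩ := hG.exists_return ha
    obtain ⟨N, hN⟩ := exists_closed_of_ge G i
    -- All walks from `i` to `j` have congruent lengths, because a fixed return walk closes each of
    -- them; conversely, long closed walks at `i` realize every large length in the class.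
    have main : ∀ m m', (∃ S, GWalk G i j m S) → N + a ≤ m' →
        m ≡ m' [MOD componentCyclicity G i] → ∃ S, GWalk G i j m' S := by
      rintro m m' ⟨S, hS⟩ hm' hmod
      have h₁ := Nat.modEq_zero_iff_dvd.mpr (hS.append hb).componentCyclicity_dvd
      have h₂ := Nat.modEq_zero_iff_dvd.mpr (ha.append hb).componentCyclicity_dvd
      have h₃ : a ≡ m' [MOD componentCyclicity G i] :=
        (Nat.ModEq.add_right_cancel' b (h₂.trans h₁.symm)).trans hmod
      obtain ⟨W, hW⟩ := hN (m' - a) (by omega) ((Nat.modEq_iff_dvd' (by omega)).mp h₃)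
      refine ⟨W ∪ U, ?_⟩
      have := hW.append ha
      rwa [Nat.sub_add_cancel (by omega)] at this
    -- The extra `1` makes the walks nonempty, so that `i` is a node and its component enters the
    -- cyclicity.
    refine Filter.eventually_atTop.mpr ⟨N + a + 1, fun t ht => ?_⟩
    have hmod : IsNode G i → t + cyclicity G ≡ t [MOD componentCyclicity G i] := fun hi => by
      simpa using (Nat.modEq_zero_iff_dvd.mpr
        (componentCyclicity_dvd_cyclicity hi)).add_left t
    constructor
    · rintro ⟨S, h⟩
      exact main _ _ ⟨S, h⟩ (by omega) (hmod (h.isNode_start (by omega)))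
    · rintro ⟨S, h⟩
      exact main _ _ ⟨S, h⟩ (by omega) (hmod (h.isNode_start (by omega))).symm
  obtain ⟨T, hT⟩ := Filter.eventually_atTop.mp
    (Filter.eventually_all.mpr fun i => Filter.eventually_all.mpr (key i))
  exact ⟨T, hG.cyclicity_pos, fun t ht => boolMatrix_pow_eq (hT t ht)⟩

/-! ### A representing subgraph consisting of disjoint cycles -/

theorem SameSCC.mono (hGH : G ≤ H) (h : SameSCC G i j) : SameSCC H i j :=
  ⟨Relation.ReflTransGen.mono (fun _ _ ha => hGH ha) _ _ h.1,
    Relation.ReflTransGen.mono (fun _ _ ha => hGH ha) _ _ h.2⟩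

theorem GWalk.eq_of_deterministic (hG : ∀ u v v', G.Adj u v → G.Adj u v' → v = v')
    (h : GWalk G i j L S) (h' : GWalk G i k L S') : j = k := by
  refine h.induction (motive := fun i L _ => ∀ S', GWalk G i k L S' → j = k) ?_ ?_ S' h'
  · intro S' h'
    cases h'
    rfl
  · intro i u L S ha _ ih S' h'
    obtain ⟨w, hw, rfl, rfl, -⟩ := h'.exists_isWalk
    have h₁ : IsWalk G L fun m => w (m + 1) := fun m hm => hw (m + 1) (by omega)
    have h₂ := GWalk.of_isWalk h₁
    rw [← hG _ _ _ ha (hw 0 (Nat.succ_pos L))] at h₂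
    exact ih _ h₂

/-- One elementary cycle per component suffices. Each node then has a single successor and returns
to itself after `cyclicity G` steps, so such a return can be prefixed to or stripped from any
nonempty walk. -/
theorem IsCompletelyReducible.exists_representing (hH : IsCompletelyReducible H) :
    ∃ G, IsRepresenting H G ∧ PeriodicFrom (boolMatrix G) 1 (cyclicity G) := by
  classical
  have hcyc : ∀ i, ∃ g w, IsNode H i → IsCycle H g w ∧ w 0 = i := by
    intro i
    by_cases hi : IsNode H i
    · obtain ⟨g, S, hg, hS, h⟩ := hH.exists_elementary hi
      obtain ⟨w, hw, h0, -⟩ := HasWalk.isCycle h hg hS one_ne_zero'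
      rw [digraph_boolMatrix] at hw
      exact ⟨g, w, fun _ => ⟨hw, h0⟩⟩
    · exact ⟨0, fun _ => i, fun h => absurd h hi⟩
  choose g w hw using hcyc
  obtain ⟨r, hr, hr'⟩ : ∃ r : Fin n → Fin n, (∀ i, SameSCC H i (r i)) ∧
      ∀ i j, SameSCC H i j → r i = r j := by
    let s : Setoid (Fin n) := ⟨SameSCC H, fun _ => ⟨.refl, .refl⟩, fun h => ⟨h.2, h.1⟩,
      fun h h' => ⟨h.1.trans h'.1, h'.2.trans h.2⟩⟩
    refine ⟨fun i => (Quotient.mk s i).out, fun i => ?_, fun i j h => ?_⟩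
    · exact s.symm (Quotient.mk_out (s := s) i)
    · exact congrArg Quotient.out (Quotient.sound (s := s) h)
  let G : Digraph (Fin n) := ⟨fun u v => ∃ i, (IsNode H i ∧ r i = i) ∧
    ∃ q < g i, w i q = u ∧ w i (q + 1) = v⟩
  have hclosed : ∀ i, IsNode H i ∧ r i = i → IsClosedWalk G (g i) (w i) := fun i hi =>
    ⟨fun q hq => ⟨i, hi, q, hq, rfl, rfl⟩, (hw i hi.1).1.2.1.2⟩
  have hle : G ≤ H := by
    rintro _ _ ⟨i, hi, q, hq, rfl, rfl⟩
    exact (hw i hi.1).1.2.1.1 q hq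
  have hnode : ∀ u, IsNode G u → ∃ i, (IsNode H i ∧ r i = i) ∧ ∃ q < g i, w i q = u := by
    rintro u ⟨v, ⟨i, hi, q, hq, h, -⟩ | ⟨i, hi, q, hq, -, h⟩⟩
    · exact ⟨i, hi, q, hq, h⟩
    · by_cases hq' : q + 1 < g i
      · exact ⟨i, hi, q + 1, hq', h⟩
      · refine ⟨i, hi, 0, by omega, ?_⟩
        rw [← (hclosed i hi).2, ← h]
        congr 1
        omega
  have hrep : ∀ i q, IsNode H i ∧ r i = i → q < g i → r (w i q) = i := by
    intro i q hi hq
    have hc := (hw i hi.1).1.2.1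
    have h0 := (hw i hi.1).2
    have : SameSCC H (w i q) (w i 0) :=
      ⟨hc.reflTransGen hq.le (Nat.zero_le _), hc.reflTransGen (Nat.zero_le _) hq.le⟩
    rw [h0] at this
    rw [hr' _ _ this, hi.2]
  have hred : IsCompletelyReducible G := by
    intro u v h
    refine ⟨.single h, ?_⟩
    obtain ⟨i, hi, q, hq, rfl, rfl⟩ := h
    exact (hclosed i hi).reflTransGen hq hq.le
  have hdet : ∀ u v v', G.Adj u v → G.Adj u v' → v = v' := by
    rintro _ _ _ ⟨i, hi, q, hq, rfl, rfl⟩ ⟨i', hi', q', hq', h, rfl⟩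
    obtain rfl : i' = i := by rw [← hrep i q hi hq, ← h, hrep i' q' hi' hq']
    rw [(hw i' hi.1).1.2.2 hq' hq h]
  have hG : IsRepresenting H G := by
    refine ⟨hle, hred, fun i hi => ?_, fun u v hu hv huv => ?_⟩
    · obtain ⟨L, S, h⟩ := GWalk.of_reflTransGen (hr i).1
      have hri : IsNode H (r i) := h.isNode_end hi
      have hrr : r (r i) = r i := (hr' _ _ (hr i)).symm
      exact ⟨r i, ⟨_, Or.inl ⟨r i, ⟨hri, hrr⟩, 0, (hw _ hri).1.1, (hw _ hri).2, rfl⟩⟩, hr i⟩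
    · obtain ⟨i, hi, q, hq, rfl⟩ := hnode u hu
      obtain ⟨i', hi', q', hq', rfl⟩ := hnode v hv
      obtain rfl : i' = i := by
        rw [← hrep i q hi hq, ← hrep i' q' hi' hq', hr' _ _ huv]
      exact ⟨(hclosed i' hi).reflTransGen hq.le hq'.le,
        (hclosed i' hi).reflTransGen hq'.le hq.le⟩
  have hret : ∀ u, IsNode G u → ∃ S, GWalk G u u (cyclicity G) S := by
    intro u hu
    obtain ⟨i, hi, q, hq, rfl⟩ := hnode u hu
    have hdvd : g i ∣ componentCyclicity G (w i q) := by
      refine Nat.dvd_setGcd_iff.mpr ?_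
      rintro L ⟨c, ⟨hc, hend⟩, hscc⟩
      obtain ⟨M, U, hM⟩ := GWalk.of_reflTransGen hscc.1
      obtain ⟨i', hi', p, hp, hpc⟩ := hnode _ (hM.isNode_end hu)
      obtain rfl : i' = i := by
        rw [← hrep i q hi hq, ← hrep i' p hi' hp, hpc, hr' _ _ (hscc.mono hle)]
      -- Out-degree one forces a walk to run around its cycle, so it closes only after a multiple of
      -- `g i'` steps.
      have hpos : ∀ m ≤ L, c m = w i' ((p + m) % g i') := by
        intro m hm
        induction m with
        | zero => rw [Nat.add_zero, Nat.mod_eq_of_lt hp, hpc]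
        | succ m ih =>
          have hlt := Nat.mod_lt (p + m) (Nat.zero_lt_of_lt hp)
          have ha := hc m hm
          rw [ih (by omega)] at ha
          rw [hdet _ _ _ ha ⟨i', hi, _, hlt, rfl, rfl⟩, ← Nat.add_assoc]
          rcases (Nat.add_one_le_of_lt hlt).lt_or_eq with h | h
          · rw [← Nat.mod_eq_of_lt h, Nat.mod_add_mod]
          · have h0 : (p + m + 1) % g i' = 0 := by
              rw [← Nat.mod_add_mod, h, Nat.mod_self]
            rw [h0, h, (hclosed i' hi).2]
      have h1 := hpos L le_rfl
      rw [hend, ← hpc] at h1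
      have h2 := (hw i' hi.1).1.2.2 hp (Nat.mod_lt _ (Nat.zero_lt_of_lt hp)) h1
      have h3 : p + L ≡ p + 0 [MOD g i'] := by
        rw [Nat.ModEq, ← h2, Nat.add_zero, Nat.mod_eq_of_lt hp]
      exact Nat.modEq_zero_iff_dvd.mp (Nat.ModEq.add_left_cancel' p h3)
    obtain ⟨m, hm⟩ := hdvd.trans (componentCyclicity_dvd_cyclicity hu)
    have h := GWalk.of_isWalk (hclosed i hi).1
    rw [(hclosed i hi).2] at h
    have h' := HasWalk.rotate h (i := w i q)
      (Finset.mem_image_of_mem _ (by simp; omega))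
    obtain ⟨T, hT⟩ := h'.closed_pow m
    rw [one_pow, mul_comm, ← hm] at hT
    exact ⟨T, hT⟩
  refine ⟨G, hG, hred.cyclicity_pos, fun t ht => boolMatrix_pow_eq fun u v => ?_⟩
  rw [add_comm]
  constructor
  · rintro ⟨S, h⟩
    obtain ⟨T, hT⟩ := hret u (h.isNode_start (by omega))
    obtain ⟨z, S₁, S₂, x₁, x₂, h₁, h₂, -, h12⟩ := HasWalk.split_at h
    have h12' := h12.symm.trans_ne one_ne_zero'
    have h₁' := GWalk.of_hasWalk h₁ (left_ne_zero_of_mul h12')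
    have h₂' := GWalk.of_hasWalk h₂ (right_ne_zero_of_mul h12')
    rw [hT.eq_of_deterministic hdet h₁']
    exact ⟨_, h₂'⟩
  · rintro ⟨S, h⟩
    obtain ⟨T, hT⟩ := hret u (h.isNode_start (by omega))
    exact ⟨_, hT.append h⟩

/-! ### The Nachtigall scheme -/

theorem nachtigall_eq_zero_or (A : Matrix (Fin n) (Fin n) Rmax) (i j : Fin n) :
    nachtigall A i j = 0 ∨ nachtigall A i j = A i j := by
  unfold nachtigall
  split_ifs <;> simp

theorem HasWalk.nachtigall (h : HasWalk A i j L S x)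
    (hS : ∀ v ∈ S, ¬ IsNode (criticalGraph A) v) : HasWalk (nachtigall A) i j L S x := by
  induction h with
  | nil i => exact .nil i
  | @cons i j k L S x h ih =>
    have e : MaxPlus.nachtigall A i j = A i j := if_neg (by
      rintro (h' | h')
      · exact hS i (Finset.mem_insert_self _ _) h'
      · exact hS j (Finset.mem_insert_of_mem h.start_mem) h')
    have := (ih fun v hv => hS v (Finset.mem_insert_of_mem hv)).cons i
    rwa [e] at this

theorem HasWalk.of_nachtigall (h : HasWalk (MaxPlus.nachtigall A) i j L S x) (hx : x ≠ 0) :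
    HasWalk A i j L S x := by
  induction h with
  | nil i => exact .nil i
  | @cons i j k L S x h ih =>
    rw [(nachtigall_eq_zero_or A i j).resolve_left (left_ne_zero_of_mul hx)]
    exact (ih (right_ne_zero_of_mul hx)).cons i

theorem HasWalk.le_smul_csr (hG : IsRepresenting (criticalGraph A) G)
    (h : HasWalk A i j t S x) (hv : IsNode (criticalGraph A) v) (hvS : v ∈ S) :
    x ≤ (ofReal (maxCycleMean A) ^ t • (csrC A G * csrS A G ^ t * csrR A G)) i j := by
  have := mul_le_mul_right (h.normalized.le_csr hG hv hvS) (ofReal (maxCycleMean A) ^ t)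
  rwa [← mul_assoc, ← mul_pow, mul_comm (ofReal _), ofReal_neg_mul, one_pow, one_mul] at this

/-- One step of the CSR decomposition. -/
theorem pow_eq_csr_add (hG : IsRepresenting (criticalGraph A) G)
    (ht : min (wielandt n) (((n : ℤ) - 2) * circumference (digraph A) + n) ≤ t) :
    A ^ t = ofReal (maxCycleMean A) ^ t • (csrC A G * csrS A G ^ t * csrR A G) +
      nachtigall A ^ t := by
  ext i j
  refine le_antisymm (HasWalk.pow_le fun S x h _ => ?_) (add_le_iff.mpr ⟨?_, ?_⟩)
  · by_cases hS : ∃ v ∈ S, IsNode (criticalGraph A) v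
    · obtain ⟨v, hvS, hv⟩ := hS
      exact (h.le_smul_csr hG hv hvS).trans (le_add_left' _ _)
    · push Not at hS
      exact (h.nachtigall hS).le_pow.trans (le_add_right' _ _)
  · rw [pow_eq_smul_normalized A]
    exact mul_le_mul_right (csr_le_pow hG.le hG.completelyReducible ht) _
  · exact HasWalk.pow_le fun S x h hx => (h.of_nachtigall hx).le_pow

theorem circumference_reduced_le (A : Matrix (Fin n) (Fin n) Rmax) (k : ℕ) :
    circumference (digraph (reduced A k)) ≤ circumference (digraph A) := by
  induction k with
  | zero => exact le_rfl
  | succ k ih =>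
    refine (circumference_mono fun i j h => ?_).trans ih
    rw [reduced] at h
    exact fun h0 => (nachtigall_eq_zero_or (reduced A k) i j).elim h fun e => h (e.trans h0)

/-- For `n ≤ 1` the coefficient `n - 2` is negative and monotonicity fails, but then the minimum is
at most `0`. -/
theorem threshold_mono {c c' : ℕ} (hc : c ≤ c')
    (ht : min (wielandt n) (((n : ℤ) - 2) * c' + n) ≤ t) :
    min (wielandt n) (((n : ℤ) - 2) * c + n) ≤ t := by
  have hc' : (c : ℤ) ≤ c' := by exact_mod_cast hc
  rcases n with _ | _ | n
  · refine (min_le_right _ _).trans ?_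
    push_cast
    omega
  · refine (min_le_left _ _).trans ?_
    simp [wielandt]
  · refine le_trans (min_le_min_left _ ?_) ht
    push_cast
    nlinarith

theorem pow_eq_sum_add (A : Matrix (Fin n) (Fin n) Rmax) {G : ℕ → Digraph (Fin n)} (K : ℕ)
    (hG : ∀ k < K, IsRepresenting (criticalGraph (reduced A k)) (G k))
    (ht : min (wielandt n) (((n : ℤ) - 2) * circumference (digraph A) + n) ≤ t) :
    A ^ t = ∑ k ∈ Finset.range K, ofReal (maxCycleMean (reduced A k)) ^ t •
      (csrC (reduced A k) (G k) * csrS (reduced A k) (G k) ^ t * csrR (reduced A k) (G k)) +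
        reduced A K ^ t := by
  induction K with
  | zero => simp [reduced]
  | succ K ih =>
    rw [ih fun k hk => hG k (by omega), Finset.sum_range_succ, add_assoc, reduced,
      ← pow_eq_csr_add (hG K (Nat.lt_succ_self K))
        (threshold_mono (circumference_reduced_le A K) ht)]

/-! ### Acyclic matrices, termination of the scheme and the full expansion -/

theorem pow_eq_zero_of_not_hasCycle (h : ¬ HasCycle (digraph B)) (ht : n ≤ t) : B ^ t = 0 := by
  ext i j
  refine le_antisymm (HasWalk.pow_le fun S x hw hx => ?_) (zero_le' _)
  obtain ⟨c, T, L₀, x₀, -, hc, -, rfl⟩ := hw.exists_loop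
    (le_trans (by simpa using Finset.card_le_univ S) ht)
  obtain ⟨⟨hpos, U, hU, hUw⟩, -⟩ := hc c (by simp)
  obtain ⟨w, hw, -⟩ := hUw.isCycle hpos hU (by simpa using right_ne_zero_of_mul hx)
  exact absurd ⟨_, w, hw⟩ h

open Classical in
/-- The nodes without incident edges in the digraph of a matrix. -/
def isolatedNodes (A : Matrix (Fin n) (Fin n) Rmax) : Finset (Fin n) :=
  Finset.univ.filter fun i => ¬ IsNode (digraph A) i

/-- Critical nodes lie on edges of `digraph A` and lose all of them, so each step isolates a new
node; this bounds the number of steps by `n`. -/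
theorem isolatedNodes_ssubset (h : HasCycle (digraph A)) :
    isolatedNodes A ⊂ isolatedNodes (nachtigall A) := by
  obtain ⟨i, hi⟩ := exists_isNode_criticalGraph h
  have hadj : ∀ u v, (digraph (nachtigall A)).Adj u v → (digraph A).Adj u v ∧
      ¬ IsNode (criticalGraph A) u ∧ ¬ IsNode (criticalGraph A) v := by
    intro u v huv
    by_cases hc : IsNode (criticalGraph A) u ∨ IsNode (criticalGraph A) v
    · exact absurd (if_pos hc) huv
    · refine ⟨fun h0 => huv ?_, not_or.mp hc⟩
      exact (nachtigall_eq_zero_or A u v).elim id fun e => e.trans h0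
  rw [Finset.ssubset_iff_of_subset]
  · refine ⟨i, ?_, ?_⟩
    · simp only [isolatedNodes, Finset.mem_filter, Finset.mem_univ, true_and]
      rintro ⟨j, hj | hj⟩
      · exact (hadj _ _ hj).2.1 hi
      · exact (hadj _ _ hj).2.2 hi
    · simp only [isolatedNodes, Finset.mem_filter, Finset.mem_univ, true_and, not_not]
      have hle : ∀ u v, (criticalGraph A).Adj u v → (digraph A).Adj u v := by
        rintro _ _ ⟨L, w, -, hw, -, m, hm, rfl, rfl⟩
        exact hw.1 m hm
      obtain ⟨j, hj⟩ := hi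
      exact ⟨j, hj.imp (hle _ _) (hle _ _)⟩
  · intro u hu
    simp only [isolatedNodes, Finset.mem_filter, Finset.mem_univ, true_and] at hu ⊢
    rintro ⟨j, hj⟩
    exact hu ⟨j, hj.imp (fun h => (hadj _ _ h).1) fun h => (hadj _ _ h).1⟩

theorem exists_not_hasCycle_reduced (A : Matrix (Fin n) (Fin n) Rmax) :
    ∃ k ≤ n, ¬ HasCycle (digraph (reduced A k)) := by
  by_contra! h
  have hcard : ∀ k ≤ n + 1, k ≤ (isolatedNodes (reduced A k)).card := by
    intro k hk
    induction k with
    | zero => exact Nat.zero_le _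
    | succ k ih =>
      exact (ih (by omega)).trans_lt (Finset.card_lt_card (isolatedNodes_ssubset (h k (by omega))))
  have h₁ := hcard (n + 1) le_rfl
  have h₂ := Finset.card_le_univ (isolatedNodes (reduced A (n + 1)))
  simp only [Fintype.card_fin] at h₂
  omega

theorem eq_zero_of_not_hasCycle {A : Matrix (Fin 1) (Fin 1) Rmax}
    (h : ¬ HasCycle (digraph A)) : A = 0 := by
  ext i j
  obtain rfl := Subsingleton.elim i j
  by_contra h0
  obtain ⟨w, hw, -⟩ := (HasWalk.single A i i).isCycle Nat.one_pos (by simp) h0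
  exact h ⟨1, w, hw⟩

theorem pow_eq_sum {A : Matrix (Fin n) (Fin n) Rmax} {G : ℕ → Digraph (Fin n)} {K : ℕ}
    (hcyc : ∀ k < K, HasCycle (digraph (reduced A k)))
    (hK : ¬ HasCycle (digraph (reduced A K)))
    (hG : ∀ k < K, IsRepresenting (criticalGraph (reduced A k)) (G k))
    (ht : min (wielandt n) (((n : ℤ) - 2) * circumference (digraph A) + n) ≤ t)
    (ht' : n = 1 → A = 0 → 1 ≤ t) :
    A ^ t = ∑ k ∈ Finset.range K, ofReal (maxCycleMean (reduced A k)) ^ t •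
      (csrC (reduced A k) (G k) * csrS (reduced A k) (G k) ^ t * csrR (reduced A k) (G k)) := by
  have main := pow_eq_sum_add A K hG ht
  by_cases hnt : n ≤ t
  · rwa [pow_eq_zero_of_not_hasCycle hK hnt, add_zero] at main
  have hn : n = 1 := by
    by_contra hn
    have h2 : (2 : ℤ) ≤ n := by omega
    rcases min_le_iff.mp ht with h | h
    · rw [wielandt, if_neg hn] at h
      nlinarith
    · have := mul_nonneg (sub_nonneg.mpr h2) (Int.natCast_nonneg (circumference (digraph A)))
      omega
  subst hn
  have hKpos : 0 < K := by
    by_contra h0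
    obtain rfl : K = 0 := by omega
    exact hnt (ht' rfl (eq_zero_of_not_hasCycle hK))
  -- For `n = 1` and `t = 0` the acyclic remainder has the identity as its power. It is absorbed
  -- because the only node is critical, so the first CSR term already dominates every walk.
  obtain ⟨v, hv⟩ := exists_isNode_criticalGraph (hcyc 0 hKpos)
  ext i j
  refine le_antisymm (HasWalk.pow_le fun S x h _ => ?_) ?_
  · rw [Matrix.sum_apply]
    refine (h.le_smul_csr (hG 0 hKpos) hv ?_).trans (le_sum (fun k =>
      (ofReal (maxCycleMean (reduced A k)) ^ t • (csrC (reduced A k) (G k) *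
        csrS (reduced A k) (G k) ^ t * csrR (reduced A k) (G k))) i j)
      (Finset.mem_range.mpr hKpos))
    rw [Subsingleton.elim v i]
    exact h.start_mem
  · rw [main]
    exact le_add_left' _ _

end

end MaxPlus

end

open MaxPlus MaxPlus.Rmax in
theorem corollary4p3 {n : ℕ} (A : Matrix (Fin n) (Fin n) Rmax) :
    ∃ K ≤ n,
      (∀ k < K, HasCycle (digraph (reduced A k))) ∧
      ¬ HasCycle (digraph (reduced A K)) ∧
      (∀ G : ℕ → Digraph (Fin n),
        (∀ k < K, IsRepresenting (criticalGraph (reduced A k)) (G k)) →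
        (∀ k < K, ∃ P, IsBoolean P ∧ (∃ T, PeriodicFrom P T (cyclicity (G k))) ∧
          DiagonallySimilar (csrS (reduced A k) (G k)) P) ∧
        ∀ t : ℕ,
          min (wielandt n) (((n : ℤ) - 2) * circumference (digraph A) + n) ≤ t →
          (n = 1 → A = 0 → 1 ≤ t) →
          A ^ t = ∑ k ∈ Finset.range K, ofReal (maxCycleMean (reduced A k)) ^ t •
            (csrC (reduced A k) (G k) * csrS (reduced A k) (G k) ^ t *
              csrR (reduced A k) (G k))) ∧
      (∀ k < K, ∃ G, IsRepresenting (criticalGraph (reduced A k)) G ∧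
        ∃ P, IsBoolean P ∧ PeriodicFrom P 1 (cyclicity G) ∧
          DiagonallySimilar (csrS (reduced A k) G) P) := by
  classical
  obtain ⟨k, hkn, hk⟩ := exists_not_hasCycle_reduced A
  have hex : ∃ k, ¬ HasCycle (digraph (reduced A k)) := ⟨k, hk⟩
  have hcyc : ∀ k < Nat.find hex, HasCycle (digraph (reduced A k)) := fun k hk =>
    not_not.mp (Nat.find_min hex hk)
  refine ⟨Nat.find hex, (Nat.find_le hk).trans hkn, hcyc, Nat.find_spec hex,
    fun G hG => ⟨fun k hk => ?_, fun t ht ht' => ?_⟩, fun k hk => ?_⟩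
  · exact ⟨boolMatrix (G k), isBoolean_boolMatrix _,
      (hG k hk).completelyReducible.exists_periodicFrom, diagonallySimilar_boolMatrix (hG k hk).le⟩
  · exact pow_eq_sum hcyc (Nat.find_spec hex) hG ht ht'
  · obtain ⟨G, hG, hper⟩ :=
      (isCompletelyReducible_criticalGraph (reduced A k)).exists_representing
    exact ⟨G, hG, boolMatrix G, isBoolean_boolMatrix G, hper, diagonallySimilar_boolMatrix hG.le⟩
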